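/- **Setting.** Let $L\ge 1$ and let $\Theta^{(L)}$ be the neural tangent kernel of the infinitely wide, bias-free, fully connected ReLU network with $L$ hidden layers in the usual normalization ($\alpha^0=x$, $\alpha^{l}=\sqrt{2/m}\,\sigma(W^{l}\alpha^{l-1})$ for $1\le l\le L$, $f=\langle a,\alpha^{L}\rangle$, with i.i.d. standard Gaussian weights, all trained), i.e. the limiting kernel of $\langle\nabla_w f(w;x),\nabla_w f(w;x')\rangle$ as the width $m\to\infty$. Explicitly, with $\sigma(t)=\max(t,0)$ and $\sigma'(t)=\mathbf 1_{t>0}$, $$\Theta^{(0)}(x,x')=\Sigma^{(0)}(x,x')=\langle x,x'\rangle,\qquad \Sigma^{(l+1)}(x,x')=2\,\mathbb E[\sigma(u)\sigma(v)],$$ $$\Theta^{(l+1)}(x,x')=\Theta^{(l)}(x,x')\cdot 2\,\mathbb E[\sigma'(u)\sigma'(v)]+\Sigma^{(l+1)}(x,x'),$$ where $(u,v)$ is a centred Gaussian pair with $\operatorname{Var}u=\Sigma^{(l)}(x,x)$, $\operatorname{Cov}(u,v)=\Sigma^{(l)}(x,x')$, $\operatorname{Var}v=\Sigma^{(l)}(x',x')$.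 For inputs $x_1,\dots,x_n\in\mathbb R^d$ let $K=(\Theta^{(L)}(x_k,x_l))_{k,l}$. **Theorem 3.2.** Let $n>2$, $L\ge1$, $i\ne j$ in $\{1,\dots,n\}$, $L_y>0$, $M>0$, and fix the inputs $x_k\in\mathbb R^d$, $k\ne i,j$. Then there are constants $c,C,\theta_0>0$, depending only on these data, such that the following holds for all $x_i,x_j\in\mathbb R^d$ for which $x_1,\dots,x_n$ have unit length, are pairwise non-parallel, and the angle $\theta$ between $x_i$ and $x_j$ satisfies $\theta\le\theta_0$. There is an eigenvalue $\lambda$ of $K$ with a unit eigenvector $v$ such that $$c\,\theta\le\lambda\le C\,\theta ,$$ and for every label vector $y\in\mathbb R^n$ with $|y_k-y_l|\le L_y\|x_k-x_l\|$ for all $k,l$ and $|y_k|\le M$ for all $k$, $$(v^\top y)^2\le C\lambda^2\qquad(\text{hence } (v^\top y)^2=O(\theta^2)).$$ Moreover the order $\lambda^2$ is attained: for some such label vector $y$ also $(v^\top y)^2\ge c\,\lambda^2$. -/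

import Mathlib

open MeasureTheory ProbabilityTheory Matrix

noncomputable section

namespace InfiniteNTK

/-- The ReLU activation `σ(t) = max(t, 0)`. -/
def relu (t : ℝ) : ℝ := max t 0

/-- The derivative of ReLU, with the usual convention `σ'(0) = 0`. -/
def reluDeriv (t : ℝ) : ℝ := if 0 < t then 1 else 0

/-- The symmetric `2 × 2` matrix with rows `(p, r)` and `(r, q)`. -/
def cov2 (p r q : ℝ) : Matrix (Fin 2) (Fin 2) ℝ := !![p, r; r, q]

/-- `2 · E[φ(u) φ(v)]` for a centred Gaussian pair `(u, v)` with `Var u = p`, `Cov(u, v) = r`,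
`Var v = q`. The factor `2` is the square of the scaling `√(2 / width)` of a ReLU layer. -/
def dualActivation (φ : ℝ → ℝ) (p r q : ℝ) : ℝ :=
  2 * ∫ g : EuclideanSpace ℝ (Fin 2), φ (g 0) * φ (g 1) ∂(multivariateGaussian 0 (cov2 p r q))

variable {d : ℕ}

/-- The covariance kernel `Σ^(l)(x, x')` of the outputs of the `l`-th hidden layer
in the infinite-width limit at Gaussian initialization: `Σ^(0)(x, x') = ⟨x, x'⟩` and
`Σ^(l+1)(x, x') = 2 E[σ(u) σ(v)]`, with `(u, v)` a centred Gaussian pair whose covariance is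
that of layer `l` at `x, x'`. -/
def layerKernel : ℕ → EuclideanSpace ℝ (Fin d) → EuclideanSpace ℝ (Fin d) → ℝ
  | 0, x, x' => inner ℝ x x'
  | l + 1, x, x' =>
      dualActivation relu (layerKernel l x x) (layerKernel l x x') (layerKernel l x' x')

/-- The derivative kernel `2 E[σ'(u) σ'(v)]`, with `(u, v)` the Gaussian pair of layer `l`
at `x, x'`. -/
def layerDerivKernel (l : ℕ) (x x' : EuclideanSpace ℝ (Fin d)) : ℝ :=
  dualActivation reluDeriv (layerKernel l x x) (layerKernel l x x') (layerKernel l x' x')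

/-- The neural tangent kernel of the infinitely wide, bias-free, fully connected ReLU network
with `L` hidden layers
`α⁰ = x`, `αˡ = √(2/m) σ(Wˡ αˡ⁻¹)` for `1 ≤ l ≤ L`, `f = ⟨a, α^L⟩`,
all entries of the `Wˡ` and of `a` being independent standard Gaussians at initialization and
all of them being trained; that is, the deterministic limit of `⟨∇f(w; x), ∇f(w; x')⟩` as the
width `m` tends to infinity, given by
`Θ^(0) = Σ^(0)` and `Θ^(l+1) = Θ^(l) · 2 E[σ'(u) σ'(v)] + Σ^(l+1)`. -/
def ntk : ℕ → EuclideanSpace ℝ (Fin d) → EuclideanSpace ℝ (Fin d) → ℝ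
  | 0, x, x' => layerKernel 0 x x'
  | L + 1, x, x' => ntk L x x' * layerDerivKernel L x x' + layerKernel (L + 1) x x'

/-- The NTK matrix `K_{ij} = Θ^(L)(x_i, x_j)` of a family of inputs. -/
def ntkMatrix {n : ℕ} (L : ℕ) (x : Fin n → EuclideanSpace ℝ (Fin d)) :
    Matrix (Fin n) (Fin n) ℝ :=
  Matrix.of fun i j => ntk L (x i) (x j)

/-- The conditions on the inputs: unit length, and pairwise non-parallel. -/
structure AdmissibleInputs {n : ℕ} (x : Fin n → EuclideanSpace ℝ (Fin d)) : Prop where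
  unit : ∀ k, ‖x k‖ = 1
  nonparallel : ∀ k l, k ≠ l → ¬ ∃ c : ℝ, x k = c • x l

/-- The labels are those of an `Ly`-Lipschitz ground-truth function. -/
def LipschitzLabels {n : ℕ} (Ly : ℝ) (x : Fin n → EuclideanSpace ℝ (Fin d))
    (y : Fin n → ℝ) : Prop :=
  ∀ k l, |y k - y l| ≤ Ly * ‖x k - x l‖

end InfiniteNTK

end

/-!
On the unit sphere the kernel depends only on the angle of its two inputs, and as a function of the
angle it has a strictly negative one-sided slope at `0`. The heart of the proof is the dual
estimate `|w ⬝ᵥ y| ≤ C * ‖K w‖_∞`, for all weights `w` and all labels `y` that are bounded and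
Lipschitz in the angle. To prove it, `w` is split into dipoles inside the cluster around the close
pair, on which `K` is diagonally dominant at the order of the angles because of the corner at `0`,
and a remainder carried by separated inputs, on which `K` is coercive: all even powers of the
cosine occur in the kernel with positive coefficients, and compactness makes the bound uniform.

For an eigenvector `w = v` the estimate gives `(v ⬝ᵥ y) ^ 2 = O(lam ^ 2)`, since `K v = lam • v`,
and the labels `y = τ • K v` attain this order. The estimate also gives `c * θ ≤ lam`: apply it to
a unit vector `u` with `‖K u‖ ≤ lam` and to the labels `θ • u`. For `lam ≤ C * θ` take the smallest
eigenvalue and the Rayleigh quotient of the dipole `e i - e j`, with `u = v`. If a third input lies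
within `θ / 2` of the pair, `θ • u` is Lipschitz only when `u` agrees at the two closest inputs;
then take the second smallest eigenvalue, the plane spanned by two dipoles, and such a `u` in the
span of the two lowest eigenvectors.
-/

noncomputable section

namespace InfiniteNTK

open Real InnerProductGeometry Filter Topology

/-! ### Centred Gaussian pairs -/

lemma posSemidef_cov2_cos (t : ℝ) : (cov2 1 (cos t) 1).PosSemidef := by
  rw [posSemidef_iff_dotProduct_mulVec]
  refine ⟨?_, fun x => ?_⟩
  · ext a b
    fin_cases a <;> fin_cases b <;> simp [cov2]
  · simp only [cov2, dotProduct, mulVec, Fin.sum_univ_two, star_trivial, of_apply, cons_val_zero,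
      cons_val_one, cons_val', cons_val_fin_one]
    have h : x 0 * (1 * x 0 + cos t * x 1) + x 1 * (cos t * x 0 + 1 * x 1) =
        (x 0 + cos t * x 1) ^ 2 + (sin t * x 1) ^ 2 := by
      linear_combination (-(x 1) ^ 2) * sin_sq_add_cos_sq t
    rw [h]
    positivity

/-- The Gaussian pair with unit variances and correlation `cos t`, built from two independent
standard Gaussians. -/
def gaussianPair (t : ℝ) (p : ℝ × ℝ) : EuclideanSpace ℝ (Fin 2) :=
  !₂[p.1, cos t * p.1 + sin t * p.2]

lemma measurable_gaussianPair (t : ℝ) : Measurable (gaussianPair t) := by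
  unfold gaussianPair
  refine (WithLp.measurable_toLp 2 _).comp (measurable_pi_lambda _ fun a => ?_)
  fin_cases a
  · simpa using measurable_fst
  · change Measurable fun p : ℝ × ℝ => cos t * p.1 + sin t * p.2
    fun_prop

lemma inner_gaussianPair (t : ℝ) (p : ℝ × ℝ) (x : EuclideanSpace ℝ (Fin 2)) :
    inner ℝ (gaussianPair t p) x = (x 0 + cos t * x 1) * p.1 + sin t * x 1 * p.2 := by
  simp only [gaussianPair, PiLp.inner_apply, Fin.sum_univ_two, RCLike.inner_apply, conj_trivial,
    cons_val_zero, cons_val_one]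
  ring

lemma map_gaussianPair (t : ℝ) :
    ((gaussianReal 0 1).prod (gaussianReal 0 1)).map (gaussianPair t) =
      multivariateGaussian 0 (cov2 1 (cos t) 1) := by
  have : IsProbabilityMeasure
      (((gaussianReal 0 1).prod (gaussianReal 0 1)).map (gaussianPair t)) :=
    Measure.isProbabilityMeasure_map (measurable_gaussianPair t).aemeasurable
  apply Measure.ext_of_charFun
  ext x
  have hexp : ∀ p : ℝ × ℝ,
      Complex.exp (((inner ℝ (gaussianPair t p) x : ℝ) : ℂ) * Complex.I) =
        Complex.exp (((x 0 + cos t * x 1 : ℝ) : ℂ) * p.1 * Complex.I) *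
          Complex.exp (((sin t * x 1 : ℝ) : ℂ) * p.2 * Complex.I) := by
    intro p
    rw [← Complex.exp_add, inner_gaussianPair]
    push_cast
    ring_nf
  have hvar : x ⬝ᵥ cov2 1 (cos t) 1 *ᵥ x = (x 0 + cos t * x 1) ^ 2 + (sin t * x 1) ^ 2 := by
    simp only [cov2, dotProduct, mulVec, Fin.sum_univ_two, of_apply, cons_val_zero,
      cons_val_one, cons_val', cons_val_fin_one]
    linear_combination (-(x 1) ^ 2) * sin_sq_add_cos_sq t
  rw [charFun_multivariateGaussian (posSemidef_cov2_cos t), charFun_apply,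
    integral_map (measurable_gaussianPair t).aemeasurable
      (Measurable.aestronglyMeasurable (by fun_prop))]
  simp_rw [hexp]
  rw [integral_prod_mul (fun a : ℝ => Complex.exp (((x 0 + cos t * x 1 : ℝ) : ℂ) * a *
    Complex.I)) (fun a : ℝ => Complex.exp (((sin t * x 1 : ℝ) : ℂ) * a * Complex.I)),
    ← charFun_apply_real, ← charFun_apply_real, charFun_gaussianReal, charFun_gaussianReal,
    ← Complex.exp_add, hvar, inner_zero_right]
  congr 1
  push_cast
  ring

lemma integral_gaussian_prod (f : ℝ × ℝ → ℝ) :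
    ∫ p, f p ∂((gaussianReal 0 1).prod (gaussianReal 0 1)) =
      ∫ p, (2 * π)⁻¹ * exp (-(p.1 ^ 2 + p.2 ^ 2) / 2) * f p := by
  rw [gaussianReal_of_var_ne_zero 0 one_ne_zero,
    prod_withDensity (measurable_gaussianPDF 0 1) (measurable_gaussianPDF 0 1),
    integral_withDensity_eq_integral_toReal_smul]
  · rw [← Measure.volume_eq_prod]
    congr 1
    ext p
    rw [ENNReal.toReal_mul, toReal_gaussianPDF, toReal_gaussianPDF, gaussianPDFReal_def,
      smul_eq_mul]
    have h2 : (√(2 * π))⁻¹ * (√(2 * π))⁻¹ = (2 * π)⁻¹ := by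
      rw [← mul_inv, Real.mul_self_sqrt (by positivity)]
    simp only [NNReal.coe_one, mul_one, sub_zero]
    rw [← h2, show -(p.1 ^ 2 + p.2 ^ 2) / 2 = -p.1 ^ 2 / 2 + -p.2 ^ 2 / 2 by ring, exp_add]
    ring
  · exact ((measurable_gaussianPDF 0 1).comp measurable_fst).mul
      ((measurable_gaussianPDF 0 1).comp measurable_snd)
  · exact ae_of_all _ fun p => ENNReal.mul_lt_top gaussianPDF_lt_top gaussianPDF_lt_top

lemma integral_radial_pow (k : ℕ) :
    ∫ r in Set.Ioi (0 : ℝ), r ^ (2 * k + 1) * exp (-r ^ 2 / 2) = 2 ^ k * (k.factorial : ℝ) := by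
  have hq : (-1 : ℝ) < ((2 * k + 1 : ℕ) : ℝ) := neg_one_lt_zero.trans_le (Nat.cast_nonneg _)
  have h := integral_rpow_mul_exp_neg_mul_rpow (b := 1 / 2) two_pos hq one_half_pos
  have e : ((2 * k + 1 : ℕ) + 1 : ℝ) / 2 = k + 1 := by push_cast; ring
  rw [neg_div, e, Real.Gamma_nat_eq_factorial] at h
  have e2 : ((1 : ℝ) / 2) ^ (-((k : ℝ) + 1)) = 2 ^ (k + 1) := by
    rw [one_div, Real.inv_rpow (by norm_num), Real.rpow_neg (by norm_num), inv_inv]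
    exact_mod_cast Real.rpow_natCast 2 (k + 1)
  rw [e2] at h
  calc _ = ∫ x in Set.Ioi (0 : ℝ), x ^ ((2 * k + 1 : ℕ) : ℝ) * exp (-(1 / 2) * x ^ (2 : ℝ)) := by
        congr 1
        ext x
        rw [Real.rpow_natCast, Real.rpow_two]
        congr 2
        ring
    _ = _ := by rw [h, pow_succ]; ring

/-- Polar coordinates for a positively homogeneous activation of degree `k`. -/
lemma dualActivation_cos_of_homogeneous (φ : ℝ → ℝ) (hm : Measurable φ) (k : ℕ)
    (hφ : ∀ r s : ℝ, 0 < r → φ (r * s) = r ^ k * φ s) (t : ℝ) :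
    dualActivation φ 1 (cos t) 1 =
      2 ^ k * (k.factorial : ℝ) / π *
        ∫ s in Set.Ioo (-π) π, φ (cos s) * φ (cos (s - t)) := by
  unfold dualActivation
  rw [← map_gaussianPair, integral_map (measurable_gaussianPair t).aemeasurable
      (Measurable.aestronglyMeasurable (by fun_prop)), integral_gaussian_prod,
      ← integral_comp_polarCoord_symm]
  have h : ∀ p ∈ polarCoord.target, p.1 • ((2 * π)⁻¹ * exp
      (-((polarCoord.symm p).1 ^ 2 + (polarCoord.symm p).2 ^ 2) / 2) *
        (φ (gaussianPair t (polarCoord.symm p) 0) * φ (gaussianPair t (polarCoord.symm p) 1))) =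
      ((2 * π)⁻¹ * (p.1 ^ (2 * k + 1) * exp (-p.1 ^ 2 / 2))) *
        (φ (cos p.2) * φ (cos (p.2 - t))) := by
    rintro ⟨r, s⟩ ⟨hr, -⟩
    have hr : 0 < r := hr
    have e0 : gaussianPair t (polarCoord.symm (r, s)) 0 = r * cos s := by
      simp [gaussianPair, polarCoord]
    have e1 : gaussianPair t (polarCoord.symm (r, s)) 1 = r * cos (s - t) := by
      simp [gaussianPair, polarCoord, cos_sub]; ring
    rw [e0, e1, hφ r _ hr, hφ r _ hr]
    have e2 : (polarCoord.symm (r, s)).1 ^ 2 + (polarCoord.symm (r, s)).2 ^ 2 = r ^ 2 := by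
      simp only [polarCoord_symm_apply]
      nlinarith [sin_sq_add_cos_sq s]
    rw [e2, smul_eq_mul]
    ring
  rw [setIntegral_congr_fun polarCoord.open_target.measurableSet h, polarCoord_target,
    Measure.volume_eq_prod,
    setIntegral_prod_mul (fun r : ℝ => (2 * π)⁻¹ * (r ^ (2 * k + 1) * exp (-r ^ 2 / 2)))
      (fun s => φ (cos s) * φ (cos (s - t))), integral_const_mul, integral_radial_pow]
  have := pi_ne_zero
  field_simp

lemma Ioo_inter_cos_pos_and_cos_sub_pos {t : ℝ} (ht : t ∈ Set.Icc 0 π) :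
    Set.Ioo (-π) π ∩ {s | 0 < cos s ∧ 0 < cos (s - t)} = Set.Ioo (t - π / 2) (π / 2) := by
  obtain ⟨h0, h1⟩ := ht
  ext s
  constructor
  · rintro ⟨⟨hs1, hs2⟩, c1, c2⟩
    refine ⟨?_, ?_⟩ <;> by_contra! h
    · have := cos_nonpos_of_pi_div_two_le_of_le (x := t - s) (by linarith)
      rw [← cos_neg, neg_sub] at c2
      by_cases hts : t - s ≤ π + π / 2
      · linarith [this (by linarith)]
      · have := cos_nonpos_of_pi_div_two_le_of_le (x := -s) (by linarith) (by linarith)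
        rw [cos_neg] at this
        linarith
    · linarith [cos_nonpos_of_pi_div_two_le_of_le h (by linarith)]
  · rintro ⟨l1, l2⟩
    exact ⟨⟨by linarith, by linarith⟩, cos_pos_of_mem_Ioo ⟨by linarith, l2⟩,
      cos_pos_of_mem_Ioo ⟨by linarith, by linarith⟩⟩

lemma setIntegral_indicator_cos_pos {t : ℝ} (ht : t ∈ Set.Icc 0 π) (f : ℝ → ℝ) :
    ∫ s in Set.Ioo (-π) π, {s | 0 < cos s ∧ 0 < cos (s - t)}.indicator f s =
      ∫ s in (t - π / 2)..(π / 2), f s := by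
  have hm : MeasurableSet {s | 0 < cos s ∧ 0 < cos (s - t)} :=
    (measurableSet_lt measurable_const measurable_cos).inter
      (measurableSet_lt measurable_const (measurable_cos.comp (measurable_id.sub_const t)))
  rw [setIntegral_indicator hm, Ioo_inter_cos_pos_and_cos_sub_pos ht,
    intervalIntegral.integral_of_le (by linarith [ht.2]), integral_Ioc_eq_integral_Ioo]

lemma dualActivation_reluDeriv_cos {t : ℝ} (ht : t ∈ Set.Icc 0 π) :
    dualActivation reluDeriv 1 (cos t) 1 = 1 - t / π := by
  have hgate : (fun s => reluDeriv (cos s) * reluDeriv (cos (s - t))) =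
      {s | 0 < cos s ∧ 0 < cos (s - t)}.indicator fun _ => 1 := by
    ext s
    simp only [reluDeriv, Set.indicator, Set.mem_ofPred_eq, ite_and, ite_mul, one_mul, zero_mul]
  rw [dualActivation_cos_of_homogeneous reluDeriv
    (Measurable.ite measurableSet_Ioi measurable_const measurable_const) 0
    (fun r s hr => by simp [reluDeriv, hr]) t, hgate, setIntegral_indicator_cos_pos ht,
    intervalIntegral.integral_const]
  simp only [pow_zero, Nat.factorial_zero, Nat.cast_one, smul_eq_mul]
  field_simp
  ring

lemma integral_cos_mul_cos_sub (t : ℝ) :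
    ∫ s in (t - π / 2)..(π / 2), cos s * cos (s - t) =
      (sin t + (π - t) * cos t) / 2 := by
  have hd : ∀ s ∈ Set.uIcc (t - π / 2) (π / 2),
      HasDerivAt (fun s => (sin (2 * s - t) / 2 + s * cos t) / 2)
        (cos s * cos (s - t)) s := by
    intro s _
    have h1 : HasDerivAt (fun s : ℝ => 2 * s - t) 2 s := by
      simpa using ((hasDerivAt_id s).const_mul 2).sub_const t
    have h2 := (((h1.sin).div_const 2).add ((hasDerivAt_id s).mul_const (cos t))).div_const 2
    refine h2.congr_deriv ?_
    have e1 : cos (2 * s - t) = cos s * cos (s - t) - sin s * sin (s - t) := by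
      rw [← cos_add]; ring_nf
    have e2 : cos t = cos s * cos (s - t) + sin s * sin (s - t) := by
      rw [← cos_sub]; ring_nf
    rw [e1, e2]
    ring
  rw [intervalIntegral.integral_eq_sub_of_hasDerivAt hd
    ((Continuous.intervalIntegrable (by fun_prop) _ _))]
  have e1 : sin (2 * (π / 2) - t) = sin t := by
    rw [show 2 * (π / 2) - t = π - t by ring, sin_pi_sub]
  have e2 : sin (2 * (t - π / 2) - t) = -sin t := by
    rw [show 2 * (t - π / 2) - t = t - π by ring, sin_sub_pi]
  rw [e1, e2]
  ring

lemma dualActivation_relu_cos {t : ℝ} (ht : t ∈ Set.Icc 0 π) :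
    dualActivation relu 1 (cos t) 1 = (sin t + (π - t) * cos t) / π := by
  have hgate : (fun s => relu (cos s) * relu (cos (s - t))) =
      {s | 0 < cos s ∧ 0 < cos (s - t)}.indicator fun s => cos s * cos (s - t) := by
    ext s
    rcases lt_or_ge 0 (cos s) with h1 | h1 <;> rcases lt_or_ge 0 (cos (s - t)) with h2 | h2 <;>
      simp [relu, Set.indicator, h1, h2, h1.not_gt, h2.not_gt, le_of_lt]
  rw [dualActivation_cos_of_homogeneous relu (measurable_id.max measurable_const) 1
    (fun r s hr => by simp [relu, mul_max_of_nonneg _ _ hr.le]) t, hgate,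
    setIntegral_indicator_cos_pos ht, integral_cos_mul_cos_sub]
  simp only [pow_one, Nat.factorial_one, Nat.cast_one]
  field_simp

/-! ### The kernel as a function of the angle -/

/-- The degree one arc-cosine kernel as a function of the angle. -/
def arcCosine (t : ℝ) : ℝ := (sin t + (π - t) * cos t) / π

/-- The angle between the hidden representations of two inputs at angle `t`. -/
def arcMap (t : ℝ) : ℝ := arccos (arcCosine t)

lemma hasDerivAt_arcCosine (t : ℝ) : HasDerivAt arcCosine (-((1 - t / π) * sin t)) t := by
  have h := ((hasDerivAt_sin t).add
    (((hasDerivAt_id t).const_sub π).mul (hasDerivAt_cos t))).div_const π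
  refine h.congr_deriv ?_
  simp only [id]
  field_simp
  ring

lemma antitoneOn_arcCosine : AntitoneOn arcCosine (Set.Icc 0 π) := by
  refine antitoneOn_of_hasDerivWithinAt_nonpos (convex_Icc _ _)
    (fun t _ => (hasDerivAt_arcCosine t).continuousAt.continuousWithinAt)
    (fun t _ => (hasDerivAt_arcCosine t).hasDerivWithinAt) fun t ht => ?_
  rw [interior_Icc] at ht
  have hgate : 0 ≤ 1 - t / π := sub_nonneg.2 (div_le_one_of_le₀ ht.2.le pi_pos.le)
  exact neg_nonpos.2 (mul_nonneg hgate (sin_nonneg_of_mem_Icc ⟨ht.1.le, ht.2.le⟩))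

lemma cos_le_arcCosine {t : ℝ} (ht : t ∈ Set.Icc 0 π) : cos t ≤ arcCosine t := by
  have hderiv : ∀ s : ℝ, HasDerivAt (fun s => sin s - s * cos s) (s * sin s) s := fun s =>
    ((hasDerivAt_sin s).sub ((hasDerivAt_id s).mul (hasDerivAt_cos s))).congr_deriv
      (by simp only [id]; ring)
  have hmono : MonotoneOn (fun s => sin s - s * cos s) (Set.Icc 0 π) := by
    refine monotoneOn_of_hasDerivWithinAt_nonneg (convex_Icc _ _)
      (fun s _ => (hderiv s).continuousAt.continuousWithinAt)
      (fun s _ => (hderiv s).hasDerivWithinAt) fun s hs => ?_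
    have hs := interior_subset hs
    exact mul_nonneg hs.1 (sin_nonneg_of_mem_Icc hs)
  have h := hmono (Set.left_mem_Icc.2 pi_pos.le) ht ht.1
  simp only [sin_zero, zero_mul, sub_zero] at h
  rw [arcCosine, le_div_iff₀ pi_pos]
  linarith

lemma sq_add_sq_sin_sub_le {s : ℝ} (hs : s ∈ Set.Icc 0 π) :
    s ^ 2 + sin s ^ 2 - 2 * s * sin s * cos s ≤ π ^ 2 := by
  have hderiv : ∀ s : ℝ, HasDerivAt (fun s => s ^ 2 + sin s ^ 2 - 2 * s * sin s * cos s)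
      (4 * s * sin s ^ 2) s := by
    intro s
    refine ((((hasDerivAt_id s).pow 2).add ((hasDerivAt_sin s).pow 2)).sub
      ((((hasDerivAt_id s).const_mul 2).mul (hasDerivAt_sin s)).mul
        (hasDerivAt_cos s))).congr_deriv ?_
    simp only [id, Nat.cast_ofNat, Nat.add_one_sub_one, pow_one, mul_one, Pi.mul_apply]
    linear_combination (-2 * s) * sin_sq_add_cos_sq s
  have hmono : MonotoneOn (fun s => s ^ 2 + sin s ^ 2 - 2 * s * sin s * cos s) (Set.Icc 0 π) := by
    refine monotoneOn_of_hasDerivWithinAt_nonneg (convex_Icc _ _)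
      (fun s _ => (hderiv s).continuousAt.continuousWithinAt)
      (fun s _ => (hderiv s).hasDerivWithinAt) fun s hs => ?_
    have hs := (interior_subset hs).1
    positivity
  simpa using hmono hs (Set.right_mem_Icc.2 pi_pos.le) hs.2

lemma sq_add_sq_arcCosine_le {t : ℝ} (ht : t ∈ Set.Icc 0 π) :
    ((1 - t / π) * sin t) ^ 2 + arcCosine t ^ 2 ≤ 1 := by
  have h := sq_add_sq_sin_sub_le (s := π - t) ⟨sub_nonneg.2 ht.2, sub_le_self _ ht.1⟩
  rw [sin_pi_sub, cos_pi_sub] at h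
  have hsum : ((1 - t / π) * sin t) ^ 2 + arcCosine t ^ 2 =
      ((π - t) ^ 2 * (sin t ^ 2 + cos t ^ 2) + sin t ^ 2 +
        2 * (π - t) * sin t * cos t) / π ^ 2 := by
    rw [arcCosine]
    field_simp
    ring
  rw [hsum, sin_sq_add_cos_sq, div_le_one (by positivity)]
  linarith

lemma cos_arcMap {t : ℝ} (ht : t ∈ Set.Icc 0 π) : cos (arcMap t) = arcCosine t := by
  have hsq : arcCosine t ^ 2 ≤ 1 := by
    linarith [sq_add_sq_arcCosine_le ht, sq_nonneg ((1 - t / π) * sin t)]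
  have habs := abs_le.1 ((sq_le_one_iff_abs_le_one _).1 hsq)
  exact cos_arccos habs.1 habs.2

lemma mul_sin_le_sin_arcMap {t : ℝ} (ht : t ∈ Set.Icc 0 π) :
    (1 - t / π) * sin t ≤ sin (arcMap t) := by
  refine le_of_sq_le_sq ?_ (sin_nonneg_of_nonneg_of_le_pi (arccos_nonneg _) (arccos_le_pi _))
  rw [sin_sq, cos_arcMap ht]
  linarith [sq_add_sq_arcCosine_le ht]

@[simp] lemma arcMap_zero : arcMap 0 = 0 := by
  simp [arcMap, arcCosine, pi_ne_zero]

@[simp] lemma arcMap_iterate_zero (l : ℕ) : arcMap^[l] 0 = 0 :=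
  Function.iterate_fixed arcMap_zero l

lemma continuous_arcMap : Continuous arcMap := by
  unfold arcMap arcCosine
  fun_prop

lemma mapsTo_arcMap : Set.MapsTo arcMap (Set.Icc 0 π) (Set.Icc 0 π) := fun _ _ =>
  ⟨arccos_nonneg _, arccos_le_pi _⟩

lemma arcMap_le {t : ℝ} (ht : t ∈ Set.Icc 0 π) : arcMap t ≤ t :=
  (arccos_le_arccos (cos_le_arcCosine ht)).trans_eq (arccos_cos ht.1 ht.2)

lemma monotoneOn_arcMap : MonotoneOn arcMap (Set.Icc 0 π) := fun _ hs _ ht hst =>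
  arccos_le_arccos (antitoneOn_arcCosine hs ht hst)

lemma mul_sin_pos {t : ℝ} (ht : t ∈ Set.Ioo 0 π) : 0 < (1 - t / π) * sin t :=
  mul_pos (sub_pos.2 ((div_lt_one pi_pos).2 ht.2)) (sin_pos_of_mem_Ioo ht)

lemma hasDerivAt_arcMap {t : ℝ} (ht : t ∈ Set.Ioo 0 π) :
    HasDerivAt arcMap ((1 - t / π) * sin t / sin (arcMap t)) t := by
  have hlt : arcCosine t ^ 2 < 1 := by
    linarith [sq_add_sq_arcCosine_le (Set.Ioo_subset_Icc_self ht), pow_pos (mul_sin_pos ht) 2]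
  have habs := abs_lt.1 ((sq_lt_one_iff_abs_lt_one _).1 hlt)
  refine ((hasDerivAt_arccos habs.1.ne' habs.2.ne).comp t
    (hasDerivAt_arcCosine t)).congr_deriv ?_
  rw [show sin (arcMap t) = √(1 - arcCosine t ^ 2) from sin_arccos _]
  ring

lemma arcMap_sub_le {s t : ℝ} (hs : 0 ≤ s) (hst : s ≤ t) (ht : t ≤ π) :
    arcMap t - arcMap s ≤ t - s := by
  have hmono : MonotoneOn (fun t => t - arcMap t) (Set.Icc 0 π) := by
    refine monotoneOn_of_hasDerivWithinAt_nonneg (convex_Icc _ _)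
      (continuous_id.sub continuous_arcMap).continuousOn
      (fun t ht => ((hasDerivAt_id t).sub
        (hasDerivAt_arcMap (interior_Icc.subset ht))).hasDerivWithinAt) fun t ht => ?_
    have ht := interior_Icc.subset ht
    have hle := mul_sin_le_sin_arcMap (Set.Ioo_subset_Icc_self ht)
    exact sub_nonneg.2 ((div_le_one ((mul_sin_pos ht).trans_le hle)).2 hle)
  linarith [hmono ⟨hs, hst.trans ht⟩ ⟨hs.trans hst, ht⟩ hst]

lemma mul_sub_le_arcMap_sub {s t b : ℝ} (hs : 0 ≤ s) (hst : s ≤ t) (htb : t ≤ b)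
    (hb : b ≤ π / 2) : (1 - b / π) * (t - s) ≤ arcMap t - arcMap s := by
  have hpi := pi_pos
  have hmono : MonotoneOn (fun t => arcMap t - (1 - b / π) * t) (Set.Icc 0 b) := by
    have hIoo : ∀ t ∈ interior (Set.Icc 0 b), t ∈ Set.Ioo 0 π := fun t ht => by
      rw [interior_Icc] at ht
      exact ⟨ht.1, ht.2.trans_le (by linarith)⟩
    refine monotoneOn_of_hasDerivWithinAt_nonneg (convex_Icc _ _)
      (continuous_arcMap.sub (by fun_prop)).continuousOn
      (fun t ht => ((hasDerivAt_arcMap (hIoo t ht)).sub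
        ((hasDerivAt_id t).const_mul _)).hasDerivWithinAt) fun t ht => ?_
    have htI := Set.Ioo_subset_Icc_self (hIoo t ht)
    have htb := (interior_subset ht).2
    have hsin : 0 < sin (arcMap t) := (mul_sin_pos (hIoo t ht)).trans_le (mul_sin_le_sin_arcMap htI)
    have hle : sin (arcMap t) ≤ sin t := sin_le_sin_of_le_of_le_pi_div_two
      (by linarith [(mapsTo_arcMap htI).1]) (htb.trans hb) (arcMap_le htI)
    have hgate : 1 - b / π ≤ 1 - t / π := by gcongr
    have hgate0 : 0 ≤ 1 - b / π := sub_nonneg.2 (div_le_one_of_le₀ (by linarith) hpi.le)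
    rw [sub_nonneg, mul_one, le_div_iff₀ hsin]
    exact mul_le_mul hgate hle hsin.le (hgate0.trans hgate)
  linarith [hmono ⟨hs, hst.trans htb⟩ ⟨hs.trans hst, htb⟩ hst]

lemma lipschitzOnWith_arcMap : LipschitzOnWith 1 arcMap (Set.Icc 0 π) := by
  refine LipschitzOnWith.of_le_add_mul 1 fun t ht s hs => ?_
  rw [NNReal.coe_one, one_mul, dist_eq]
  rcases le_total s t with hst | hst
  · linarith [arcMap_sub_le hs.1 hst ht.2, le_abs_self (t - s)]
  · linarith [monotoneOn_arcMap ht hs hst, abs_nonneg (t - s)]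

lemma lipschitzOnWith_arcMap_iterate (l : ℕ) : LipschitzOnWith 1 arcMap^[l] (Set.Icc 0 π) := by
  induction l with
  | zero => exact LipschitzWith.id.lipschitzOnWith
  | succ l ih =>
    rw [Function.iterate_succ]
    simpa using ih.comp lipschitzOnWith_arcMap mapsTo_arcMap

/-- The neural tangent kernel on the unit sphere as a function of the angle. -/
def ntkProfile : ℕ → ℝ → ℝ
  | 0, t => cos t
  | L + 1, t => ntkProfile L t * (1 - arcMap^[L] t / π) + cos (arcMap^[L + 1] t)

@[simp] lemma ntkProfile_apply_zero (L : ℕ) : ntkProfile L 0 = L + 1 := by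
  induction L with
  | zero => simp [ntkProfile]
  | succ L ih => simp [ntkProfile, ih]

lemma gate_mem_Icc {t : ℝ} (ht : t ∈ Set.Icc 0 π) (l : ℕ) :
    1 - arcMap^[l] t / π ∈ Set.Icc (0 : ℝ) 1 := by
  have h := mapsTo_arcMap.iterate l ht
  exact ⟨sub_nonneg.2 (div_le_one_of_le₀ h.2 pi_pos.le), sub_le_self _ (div_nonneg h.1 pi_pos.le)⟩

lemma abs_ntkProfile_le {t : ℝ} (ht : t ∈ Set.Icc 0 π) (L : ℕ) : |ntkProfile L t| ≤ L + 1 := by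
  induction L with
  | zero => simpa [ntkProfile] using abs_cos_le_one t
  | succ L ih =>
    have hg := gate_mem_Icc ht L
    push_cast
    refine (abs_add_le _ _).trans (add_le_add ?_ (abs_cos_le_one _))
    rw [abs_mul, abs_of_nonneg hg.1]
    exact (mul_le_of_le_one_right (abs_nonneg _) hg.2).trans ih

lemma lipschitzOnWith_mul {s : Set ℝ} {f g : ℝ → ℝ} {A B Kf Kg : NNReal}
    (hf : LipschitzOnWith Kf f s) (hg : LipschitzOnWith Kg g s) (hA : ∀ t ∈ s, |f t| ≤ A)
    (hB : ∀ t ∈ s, |g t| ≤ B) : LipschitzOnWith (A * Kg + B * Kf) (fun t => f t * g t) s := by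
  refine LipschitzOnWith.of_dist_le_mul fun t ht u hu => ?_
  have hfg : f t * g t - f u * g u = f t * (g t - g u) + g u * (f t - f u) := by ring
  calc dist (f t * g t) (f u * g u)
      ≤ |f t| * |g t - g u| + |g u| * |f t - f u| := by
        rw [dist_eq, hfg, ← abs_mul, ← abs_mul]
        exact abs_add_le _ _
    _ ≤ A * (Kg * dist t u) + B * (Kf * dist t u) := by
        gcongr
        exacts [hA t ht, hg.dist_le_mul t ht u hu, hB u hu, hf.dist_le_mul t ht u hu]
    _ = ↑(A * Kg + B * Kf) * dist t u := by push_cast; ring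

lemma lipschitzOnWith_cos_arcMap_iterate (l : ℕ) :
    LipschitzOnWith 1 (fun t => cos (arcMap^[l] t)) (Set.Icc 0 π) := by
  simpa using! lipschitzWith_cos.comp_lipschitzOnWith (lipschitzOnWith_arcMap_iterate l)

lemma lipschitzOnWith_gate (l : ℕ) :
    LipschitzOnWith 1 (fun t => 1 - arcMap^[l] t / π) (Set.Icc 0 π) := by
  refine LipschitzOnWith.of_dist_le_mul fun t ht s hs => ?_
  have h := (lipschitzOnWith_arcMap_iterate l).dist_le_mul s hs t ht
  rw [dist_eq, dist_comm] at h
  rw [dist_eq, sub_sub_sub_cancel_left, ← sub_div, abs_div, abs_of_pos pi_pos]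
  exact (div_le_self (abs_nonneg _) (by linarith [pi_gt_three])).trans h

lemma exists_lipschitzOnWith_ntkProfile (L : ℕ) :
    ∃ K : NNReal, LipschitzOnWith K (ntkProfile L) (Set.Icc 0 π) := by
  induction L with
  | zero => exact ⟨1, lipschitzOnWith_cos_arcMap_iterate 0⟩
  | succ L ih =>
    obtain ⟨K, hK⟩ := ih
    refine ⟨_, (lipschitzOnWith_mul (A := L + 1) (B := 1) hK (lipschitzOnWith_gate L)
      (fun t ht => by simpa using abs_ntkProfile_le ht L) fun t ht => ?_).add
      (lipschitzOnWith_cos_arcMap_iterate (L + 1))⟩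
    have hg := gate_mem_Icc ht L
    rw [abs_of_nonneg hg.1]
    exact hg.2

/-- `f` has strict derivative `f'` at `a` from the right: `f t - f s = f' * (t - s) + o(t - s)`
as `s, t ≥ a` tend to `a`. -/
abbrev HasStrictRightDerivAt (f : ℝ → ℝ) (f' a : ℝ) : Prop :=
  HasDerivAtFilter f f' (𝓝[≥] a ×ˢ 𝓝[≥] a)

lemma HasStrictRightDerivAt.mul {f g : ℝ → ℝ} {f' g' a : ℝ} (hf : HasStrictRightDerivAt f f' a)
    (hg : HasStrictRightDerivAt g g' a) (hfc : ContinuousWithinAt f (Set.Ici a) a)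
    (hgc : ContinuousWithinAt g (Set.Ici a) a) :
    HasStrictRightDerivAt (fun t => f t * g t) (f' * g a + f a * g') a := by
  have htendsto := hfc.tendsto.prodMk_nhds hgc.tendsto
  have h := HasFDerivAtFilter.comp
    (hasStrictFDerivAt_fst (𝕜 := ℝ) (p := (f a, g a)) |>.mul hasStrictFDerivAt_snd)
    (HasDerivAtFilter.prodMk hf hg).hasFDerivAtFilter
    ((htendsto.prodMap htendsto).mono_right nhds_prod_eq.ge)
  have hderiv := h.hasDerivAtFilter
  simp only [ContinuousLinearMap.comp_apply, ContinuousLinearMap.toSpanSingleton_apply, one_smul,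
    _root_.add_apply, _root_.smul_apply, ContinuousLinearMap.coe_fst',
    ContinuousLinearMap.coe_snd', smul_eq_mul] at hderiv
  rwa [add_comm, mul_comm f']

lemma tendsto_arcMap_zero : Tendsto arcMap (𝓝[≥] 0) (𝓝[≥] 0) := by
  refine tendsto_nhdsWithin_iff.2 ⟨?_, .of_forall fun t => arccos_nonneg _⟩
  simpa using (continuous_arcMap.tendsto 0).mono_left nhdsWithin_le_nhds

lemma hasStrictRightDerivAt_arcMap : HasStrictRightDerivAt arcMap 1 0 := by
  refine hasDerivAtFilter_iff_isLittleO.2 (Asymptotics.isLittleO_iff.2 fun ε hε => ?_)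
  set b := min (ε * π) (π / 2)
  have hb : 0 < b := lt_min (by positivity) (by positivity)
  have hbε : b / π ≤ ε := (div_le_iff₀ pi_pos).2 (min_le_left _ _)
  have hmain : ∀ s t, 0 ≤ s → s ≤ t → t ≤ b → |arcMap t - arcMap s - (t - s)| ≤ ε * (t - s) := by
    intro s t hs hst ht
    have hlow := mul_sub_le_arcMap_sub hs hst ht (min_le_right _ _)
    have hup := arcMap_sub_le hs hst (by linarith [min_le_right (ε * π) (π / 2), pi_pos])
    rw [abs_of_nonpos (by linarith)]
    nlinarith
  have hnear : ∀ᶠ t in 𝓝[≥] (0 : ℝ), t ∈ Set.Icc 0 b := Icc_mem_nhdsGE hb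
  filter_upwards [hnear.prod_mk hnear] with ⟨t, s⟩ ⟨ht, hs⟩
  simp only [smul_eq_mul, mul_one, norm_eq_abs]
  rcases le_total s t with hst | hst
  · rw [abs_of_nonneg (sub_nonneg.2 hst)]
    exact hmain s t hs.1 hst ht.2
  · rw [abs_sub_comm t s, abs_of_nonneg (sub_nonneg.2 hst), ← abs_neg]
    convert! hmain t s ht.1 hst hs.2 using 2
    ring

lemma tendsto_arcMap_iterate_zero (l : ℕ) : Tendsto arcMap^[l] (𝓝[≥] 0) (𝓝[≥] 0) := by
  induction l with
  | zero => exact tendsto_id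
  | succ l ih => exact ih.comp tendsto_arcMap_zero

lemma continuous_ntkProfile (L : ℕ) : Continuous (ntkProfile L) := by
  have hiter : ∀ l, Continuous arcMap^[l] := continuous_arcMap.iterate
  induction L with
  | zero => exact continuous_cos
  | succ L ih =>
    exact (ih.mul (continuous_const.sub ((hiter L).div_const π))).add
      (continuous_cos.comp (hiter (L + 1)))

lemma hasStrictRightDerivAt_ntkProfile (L : ℕ) :
    HasStrictRightDerivAt (ntkProfile L) (-(L * (L + 1) / (2 * π))) 0 := by
  have hcos : HasStrictRightDerivAt cos 0 0 := by
    have h : HasStrictDerivAt cos (-sin 0) 0 := hasStrictDerivAt_cos 0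
    rw [sin_zero, neg_zero] at h
    refine HasDerivAtFilter.mono h ?_
    rw [nhds_prod_eq]
    exact prod_mono nhdsWithin_le_nhds nhdsWithin_le_nhds
  have hiter : ∀ l, HasStrictRightDerivAt arcMap^[l] 1 0 := fun l => by
    simpa using hasStrictRightDerivAt_arcMap.iterate
      (tendsto_arcMap_zero.prodMap tendsto_arcMap_zero) l
  induction L with
  | zero => simpa [ntkProfile, funext_iff] using! hcos
  | succ L ih =>
    have hgate : HasStrictRightDerivAt (fun t => 1 - arcMap^[L] t / π) (-(1 / π)) 0 := by
      simpa [div_eq_inv_mul] using ((hiter L).const_smul π⁻¹).const_sub 1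
    have hgatec : Continuous fun t => 1 - arcMap^[L] t / π :=
      continuous_const.sub ((continuous_arcMap.iterate L).div_const π)
    have hcomp := hcos.comp (hiter (L + 1))
      ((tendsto_arcMap_iterate_zero (L + 1)).prodMap (tendsto_arcMap_iterate_zero (L + 1)))
    have h := (ih.mul hgate (continuous_ntkProfile L).continuousWithinAt
      hgatec.continuousWithinAt).add hcomp
    convert! h using 1
    rw [ntkProfile_apply_zero, arcMap_iterate_zero]
    push_cast
    field_simp
    ring

lemma exists_ntkProfile_slope {L : ℕ} (hL : 1 ≤ L) :
    ∃ c₀ η : ℝ, 0 < c₀ ∧ 0 < η ∧ ∀ s t, 0 ≤ s → s ≤ t → t ≤ η →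
      9 / 10 * c₀ * (t - s) ≤ ntkProfile L s - ntkProfile L t ∧
        ntkProfile L s - ntkProfile L t ≤ 11 / 10 * c₀ * (t - s) := by
  have hL' : (1 : ℝ) ≤ L := by exact_mod_cast hL
  set c₀ : ℝ := L * (L + 1) / (2 * π) with hc₀
  have hc : 0 < c₀ := by positivity
  have hderiv := (Asymptotics.isLittleO_iff.1
    (hasDerivAtFilter_iff_isLittleO.1 (hasStrictRightDerivAt_ntkProfile L)))
    (show 0 < c₀ / 10 by positivity)
  obtain ⟨η, hη, h⟩ := nhdsGE_basis_Icc.prod_self.eventually_iff.1 hderiv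
  refine ⟨c₀, η, hc, hη, fun s t hs hst ht => ?_⟩
  have hle := h (x := (t, s)) ⟨⟨hs.trans hst, ht⟩, hs, hst.trans ht⟩
  rw [smul_eq_mul, ← hc₀, norm_eq_abs, norm_eq_abs, abs_of_nonneg (sub_nonneg.2 hst),
    abs_le] at hle
  constructor <;> linarith [hle.1, hle.2]

section Layers

variable {d : ℕ} {x x' : EuclideanSpace ℝ (Fin d)}

lemma angle_mem_Icc {E : Type*} [NormedAddCommGroup E] [InnerProductSpace ℝ E] (u v : E) :
    angle u v ∈ Set.Icc 0 π :=
  ⟨angle_nonneg u v, angle_le_pi u v⟩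

lemma layerKernel_eq_cos (l : ℕ) (hx : ‖x‖ = 1) (hx' : ‖x'‖ = 1) :
    layerKernel l x x' = cos (arcMap^[l] (angle x x')) := by
  induction l generalizing x x' with
  | zero => simp [layerKernel, cos_angle, hx, hx']
  | succ l ih =>
    have hself : ∀ {u : EuclideanSpace ℝ (Fin d)}, ‖u‖ = 1 → layerKernel l u u = 1 := fun hu => by
      simp [ih hu hu, angle_self (norm_ne_zero_iff.1 (hu.trans_ne one_ne_zero))]
    have hmem := mapsTo_arcMap.iterate l (angle_mem_Icc x x')
    rw [layerKernel, hself hx, hself hx', ih hx hx', dualActivation_relu_cos hmem,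
      Function.iterate_succ_apply', cos_arcMap hmem, arcCosine]

lemma layerDerivKernel_eq (l : ℕ) (hx : ‖x‖ = 1) (hx' : ‖x'‖ = 1) :
    layerDerivKernel l x x' = 1 - arcMap^[l] (angle x x') / π := by
  have hself : ∀ {u : EuclideanSpace ℝ (Fin d)}, ‖u‖ = 1 → layerKernel l u u = 1 := fun hu => by
    simp [layerKernel_eq_cos l hu hu, angle_self (norm_ne_zero_iff.1 (hu.trans_ne one_ne_zero))]
  rw [layerDerivKernel, hself hx, hself hx', layerKernel_eq_cos l hx hx',
    dualActivation_reluDeriv_cos (mapsTo_arcMap.iterate l (angle_mem_Icc x x'))]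

lemma ntk_eq_ntkProfile (L : ℕ) (hx : ‖x‖ = 1) (hx' : ‖x'‖ = 1) :
    ntk L x x' = ntkProfile L (angle x x') := by
  induction L with
  | zero => simpa [ntk, ntkProfile] using layerKernel_eq_cos 0 hx hx'
  | succ L ih =>
    rw [ntk, ih, layerDerivKernel_eq L hx hx', layerKernel_eq_cos (L + 1) hx hx', ntkProfile]

end Layers

/-! ### Positive definiteness on the sphere -/

section EntrywisePosSemidef

variable {f g : ℝ → ℝ} {s t : Set ℝ}

lemma dotProduct_mulVec_eq_sum {ι : Type*} [Fintype ι] (S : Matrix ι ι ℝ) (w : ι → ℝ) :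
    w ⬝ᵥ S *ᵥ w = ∑ k, ∑ l, w k * w l * S k l := by
  simp only [dotProduct, mulVec, Finset.mul_sum]
  exact Finset.sum_congr rfl fun k _ => Finset.sum_congr rfl fun l _ => by ring

/-- The function `f`, applied entrywise, preserves positive semidefiniteness of matrices with
entries in `s`. -/
def EntrywisePosSemidefOn (f : ℝ → ℝ) (s : Set ℝ) : Prop :=
  ∀ ⦃n : ℕ⦄ ⦃S : Matrix (Fin n) (Fin n) ℝ⦄,
    S.PosSemidef → (∀ k l, S k l ∈ s) → (S.map f).PosSemidef

lemma posSemidef_map_of_dotProduct_nonneg {ι : Type*} [Fintype ι] {S : Matrix ι ι ℝ}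
    (hS : S.PosSemidef) (h : ∀ w, 0 ≤ w ⬝ᵥ S.map f *ᵥ w) : (S.map f).PosSemidef :=
  .of_dotProduct_mulVec_nonneg (hS.isHermitian.map f fun _ => rfl) h

namespace EntrywisePosSemidefOn

lemma posSemidef_map (hf : EntrywisePosSemidefOn f s) {ι : Type*} [Finite ι]
    {S : Matrix ι ι ℝ} (hS : S.PosSemidef) (hs : ∀ k l, S k l ∈ s) : (S.map f).PosSemidef :=
  (posSemidef_submatrix_equiv (Finite.equivFin ι).symm).1 <|
    hf ((posSemidef_submatrix_equiv (Finite.equivFin ι).symm).2 hS) fun _ _ => hs _ _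

lemma id : EntrywisePosSemidefOn (fun r => r) s := fun _ _ hS _ => hS

lemma const {c : ℝ} (hc : 0 ≤ c) : EntrywisePosSemidefOn (fun _ => c) s := fun n S hS _ =>
  posSemidef_map_of_dotProduct_nonneg hS fun w => by
    have h : w ⬝ᵥ S.map (fun _ => c) *ᵥ w = c * (∑ k, w k) ^ 2 := by
      simp only [dotProduct_mulVec_eq_sum, map_apply, ← Finset.sum_mul, ← Finset.mul_sum]
      ring
    rw [h]
    positivity

lemma add (hf : EntrywisePosSemidefOn f s) (hg : EntrywisePosSemidefOn g s) :
    EntrywisePosSemidefOn (fun r => f r + g r) s := fun _ _ hS h => (hf hS h).add (hg hS h)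

lemma mul (hf : EntrywisePosSemidefOn f s) (hg : EntrywisePosSemidefOn g s) :
    EntrywisePosSemidefOn (fun r => f r * g r) s := fun _ _ hS h => (hf hS h).hadamard (hg hS h)

lemma const_mul (hf : EntrywisePosSemidefOn f s) {c : ℝ} (hc : 0 ≤ c) :
    EntrywisePosSemidefOn (fun r => c * f r) s := (const hc).mul hf

lemma pow (n : ℕ) : EntrywisePosSemidefOn (· ^ n) s := by
  induction n with
  | zero => simpa only [pow_zero] using const zero_le_one
  | succ n ih => simpa only [pow_succ] using ih.mul id

lemma congr (hf : EntrywisePosSemidefOn f s) (h : Set.EqOn f g s) :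
    EntrywisePosSemidefOn g s := fun n S hS hs => by
  have e : S.map g = S.map f := by
    ext k l
    exact (h (hs k l)).symm
  exact e ▸ hf hS hs

lemma comp (hg : EntrywisePosSemidefOn g t) (hf : EntrywisePosSemidefOn f s)
    (h : Set.MapsTo f s t) : EntrywisePosSemidefOn (fun r => g (f r)) s := fun _ _ hS hs =>
  hg (hf hS hs) fun k l => h (hs k l)

lemma hasSum {F : ℕ → ℝ → ℝ} (hF : ∀ n, EntrywisePosSemidefOn (F n) s)
    (hf : ∀ r ∈ s, HasSum (fun n => F n r) (f r)) : EntrywisePosSemidefOn f s := fun n S hS hs =>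
  posSemidef_map_of_dotProduct_nonneg hS fun w => by
    have h : HasSum (fun n => w ⬝ᵥ S.map (F n) *ᵥ w) (w ⬝ᵥ S.map f *ᵥ w) := by
      simp only [dotProduct_mulVec_eq_sum, map_apply]
      exact hasSum_sum fun k _ => hasSum_sum fun l _ => (hf _ (hs k l)).mul_left _
    exact h.nonneg fun n => (hF n hS hs).dotProduct_mulVec_nonneg w

/-- Along `t • S` the quadratic form of `(t • S).map f` has the derivative `S ⊙ (t • S).map f'`,
which is positive semidefinite by the Schur product theorem. -/
lemma of_hasDerivAt {f' : ℝ → ℝ} (hf : Continuous f) (hf0 : 0 ≤ f 0)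
    (hd : ∀ r ∈ Set.Ioo (-1) 1, HasDerivAt f (f' r) r)
    (hf' : EntrywisePosSemidefOn f' (Set.Ioo (-1) 1)) :
    EntrywisePosSemidefOn f (Set.Icc (-1) 1) := fun n S hS h1 =>
  posSemidef_map_of_dotProduct_nonneg hS fun w => by
    have hmem : ∀ t ∈ Set.Ioo (0 : ℝ) 1, ∀ k l, t * S k l ∈ Set.Ioo (-1) 1 := fun t ht k l =>
      ⟨by nlinarith [(h1 k l).1, ht.1, ht.2], by nlinarith [(h1 k l).2, ht.1, ht.2]⟩
    have hder : ∀ t ∈ Set.Ioo (0 : ℝ) 1, HasDerivAt (fun t => w ⬝ᵥ S.map (fun r => f (t * r)) *ᵥ w)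
        (w ⬝ᵥ (S ⊙ (t • S).map f') *ᵥ w) t := fun t ht => by
      simp only [dotProduct_mulVec_eq_sum, map_apply, hadamard_apply, Matrix.smul_apply,
        smul_eq_mul]
      refine HasDerivAt.fun_sum fun k _ => HasDerivAt.fun_sum fun l _ => ?_
      refine (((hd _ (hmem t ht k l)).comp t
        ((hasDerivAt_id t).mul_const (S k l))).const_mul (w k * w l)).congr_deriv ?_
      ring
    have hmono : MonotoneOn (fun t => w ⬝ᵥ S.map (fun r => f (t * r)) *ᵥ w) (Set.Icc 0 1) := by
      refine monotoneOn_of_hasDerivWithinAt_nonneg (convex_Icc _ _) ?_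
        (fun t ht => (hder t (interior_Icc (a := (0 : ℝ)) ▸ ht)).hasDerivWithinAt) fun t ht => ?_
      · simp only [dotProduct_mulVec_eq_sum, map_apply]
        exact Continuous.continuousOn (by fun_prop)
      · rw [interior_Icc] at ht
        exact (hS.hadamard (hf' (hS.smul ht.1.le) (hmem t ht))).dotProduct_mulVec_nonneg w
    calc 0 ≤ w ⬝ᵥ S.map (fun r => f (0 * r)) *ᵥ w := by
          simp only [zero_mul]
          exact (const hf0 hS h1).dotProduct_mulVec_nonneg w
      _ ≤ w ⬝ᵥ S.map (fun r => f (1 * r)) *ᵥ w :=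
          hmono (Set.left_mem_Icc.2 zero_le_one) (Set.right_mem_Icc.2 zero_le_one) zero_le_one
      _ = w ⬝ᵥ S.map f *ᵥ w := by simp only [one_mul]

end EntrywisePosSemidefOn

/-- The coefficients of the power series of `(1 - u)^(-1/2)`. -/
def invSqrtCoeff (n : ℕ) : ℝ := Ring.choose ((1 / 2 : ℝ) + n - 1) n

lemma invSqrtCoeff_pos (n : ℕ) : 0 < invSqrtCoeff n := by
  have h := Ring.factorial_nsmul_multichoose_eq_ascPochhammer (1 / 2 : ℝ) n
  rw [← Polynomial.ascPochhammer_smeval_cast ℝ, ← Polynomial.eval_eq_smeval, nsmul_eq_mul] at h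
  have hpos : 0 < (n.factorial : ℝ) * Ring.multichoose (1 / 2 : ℝ) n :=
    h ▸ ascPochhammer_pos n _ one_half_pos
  have e : (1 / 2 : ℝ) + n - 1 - n + 1 = 1 / 2 := by ring
  rw [invSqrtCoeff, Ring.choose, e]
  exact pos_of_mul_pos_right hpos (Nat.cast_nonneg _)

lemma hasSum_invSqrt {r : ℝ} (hr : r ∈ Set.Ioo (-1) 1) :
    HasSum (fun n => invSqrtCoeff n * r ^ (2 * n)) (1 / √(1 - r ^ 2)) := by
  have h := (one_div_one_sub_rpow_hasFPowerSeriesOnBall_zero (1 / 2)).hasSum (y := r ^ 2) (by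
    rw [Metric.mem_eball, edist_zero_right, enorm_eq_nnnorm, ENNReal.coe_lt_one_iff,
      ← NNReal.coe_lt_coe, coe_nnnorm, norm_pow, norm_eq_abs, NNReal.coe_one]
    exact pow_lt_one₀ (abs_nonneg r) (abs_lt.2 hr) two_ne_zero)
  simp only [zero_add, ← sqrt_eq_rpow, FormalMultilinearSeries.ofScalars_apply_eq, smul_eq_mul,
    ← pow_mul] at h
  exact h

lemma entrywisePosSemidefOn_invSqrt_sub (m : ℕ) :
    EntrywisePosSemidefOn (fun r => 1 / √(1 - r ^ 2) - invSqrtCoeff m * r ^ (2 * m))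
      (Set.Ioo (-1) 1) := by
  refine .hasSum (F := fun n r => if n = m then 0 else invSqrtCoeff n * r ^ (2 * n))
    (fun n => ?_) fun r hr => ?_
  · split_ifs
    · exact .const le_rfl
    · exact (EntrywisePosSemidefOn.pow _).const_mul (invSqrtCoeff_pos n).le
  · refine ((hasSum_invSqrt hr).sub (hasSum_ite_eq m (invSqrtCoeff m * r ^ (2 * m)))).congr_fun
      fun n => ?_
    split_ifs with h <;> simp [h]

lemma entrywisePosSemidefOn_arcsin_sub (m : ℕ) :
    EntrywisePosSemidefOn
      (fun r => arcsin r - invSqrtCoeff m / (2 * m + 1) * r ^ (2 * m + 1)) (Set.Icc (-1) 1) := by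
  refine .of_hasDerivAt (by fun_prop) (by simp) (fun r hr => ?_)
    (entrywisePosSemidefOn_invSqrt_sub m)
  refine ((hasDerivAt_arcsin hr.1.ne' hr.2.ne).sub ((hasDerivAt_pow (2 * m + 1) r).const_mul
    (invSqrtCoeff m / (2 * m + 1)))).congr_deriv ?_
  have : (2 * (m : ℝ) + 1) ≠ 0 := by positivity
  push_cast
  field_simp

/-- A primitive of the arcsine. -/
def arcsinPrimitive (r : ℝ) : ℝ := √(1 - r ^ 2) + r * arcsin r

lemma hasDerivAt_arcsinPrimitive {r : ℝ} (hr : r ∈ Set.Ioo (-1) 1) :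
    HasDerivAt arcsinPrimitive (arcsin r) r := by
  have hpos : 0 < 1 - r ^ 2 := by nlinarith [hr.1, hr.2]
  have hsqrt : √(1 - r ^ 2) ≠ 0 := (sqrt_pos.2 hpos).ne'
  refine ((((hasDerivAt_pow 2 r).const_sub 1).sqrt hpos.ne').add ((hasDerivAt_id r).mul
    (hasDerivAt_arcsin hr.1.ne' hr.2.ne))).congr_deriv ?_
  simp only [_root_.id, Nat.cast_ofNat]
  field_simp
  ring

lemma entrywisePosSemidefOn_arcsinPrimitive_sub (m : ℕ) :
    EntrywisePosSemidefOn (fun r => arcsinPrimitive r -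
      invSqrtCoeff m / ((2 * m + 1) * (2 * m + 2)) * r ^ (2 * m + 2)) (Set.Icc (-1) 1) := by
  refine .of_hasDerivAt (by unfold arcsinPrimitive; fun_prop) (by simp [arcsinPrimitive])
    (fun r hr => ?_) fun n S hS h => entrywisePosSemidefOn_arcsin_sub m hS fun k l =>
      Set.Ioo_subset_Icc_self (h k l)
  refine ((hasDerivAt_arcsinPrimitive hr).sub ((hasDerivAt_pow (2 * m + 2) r).const_mul
    (invSqrtCoeff m / ((2 * m + 1) * (2 * m + 2))))).congr_deriv ?_
  have : (2 * (m : ℝ) + 2) ≠ 0 := by positivity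
  push_cast
  field_simp

lemma arcCosine_arccos {r : ℝ} (hr : r ∈ Set.Icc (-1) 1) :
    arcCosine (arccos r) = r / 2 + arcsinPrimitive r / π := by
  rw [arcCosine, sin_arccos, cos_arccos hr.1 hr.2, arcsinPrimitive,
    arcsin_eq_pi_div_two_sub_arccos]
  field_simp
  ring

lemma entrywisePosSemidefOn_arcsin : EntrywisePosSemidefOn arcsin (Set.Icc (-1) 1) :=
  ((entrywisePosSemidefOn_arcsin_sub 0).add (EntrywisePosSemidefOn.id.const_mul
    (invSqrtCoeff_pos 0).le)).congr fun r _ => by simp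

lemma entrywisePosSemidefOn_arcCosine_sub (m : ℕ) :
    EntrywisePosSemidefOn (fun r => arcCosine (arccos r) - (r / 2 +
      invSqrtCoeff m / ((2 * m + 1) * (2 * m + 2)) / π * r ^ (2 * m + 2))) (Set.Icc (-1) 1) :=
  ((entrywisePosSemidefOn_arcsinPrimitive_sub m).const_mul (inv_pos.2 pi_pos).le).congr
    fun r hr => by
      rw [arcCosine_arccos hr]
      ring

lemma arccos_mem_Icc (r : ℝ) : arccos r ∈ Set.Icc 0 π := ⟨arccos_nonneg r, arccos_le_pi r⟩

lemma entrywisePosSemidefOn_arcCosine :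
    EntrywisePosSemidefOn (fun r => arcCosine (arccos r)) (Set.Icc (-1) 1) :=
  ((entrywisePosSemidefOn_arcCosine_sub 0).add ((EntrywisePosSemidefOn.id.const_mul
    one_half_pos.le).add ((EntrywisePosSemidefOn.pow 2).const_mul
      (c := invSqrtCoeff 0 / 2 / π) (by have := invSqrtCoeff_pos 0; positivity)))).congr
    fun r _ => by
      norm_num
      ring

lemma entrywisePosSemidefOn_layer (l : ℕ) :
    EntrywisePosSemidefOn (fun r => cos (arcMap^[l] (arccos r))) (Set.Icc (-1) 1) := by
  induction l with
  | zero => exact EntrywisePosSemidefOn.id.congr fun r hr => (cos_arccos hr.1 hr.2).symm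
  | succ l ih =>
    refine (entrywisePosSemidefOn_arcCosine.comp ih fun r _ => cos_mem_Icc _).congr fun r _ => ?_
    have h := mapsTo_arcMap.iterate l (arccos_mem_Icc r)
    rw [Function.iterate_succ_apply', cos_arcMap h]
    simp only [arccos_cos h.1 h.2]

lemma entrywisePosSemidefOn_gate_sub (l : ℕ) :
    EntrywisePosSemidefOn (fun r => 1 - arcMap^[l] (arccos r) / π - 1 / 2)
      (Set.Icc (-1) 1) := by
  refine ((entrywisePosSemidefOn_arcsin.const_mul (inv_pos.2 pi_pos).le).comp
    (entrywisePosSemidefOn_layer l) fun r _ => cos_mem_Icc _).congr fun r _ => ?_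
  have h := mapsTo_arcMap.iterate l (arccos_mem_Icc r)
  simp only [arcsin_eq_pi_div_two_sub_arccos, arccos_cos h.1 h.2]
  field_simp
  ring

lemma entrywisePosSemidefOn_gate (l : ℕ) :
    EntrywisePosSemidefOn (fun r => 1 - arcMap^[l] (arccos r) / π) (Set.Icc (-1) 1) :=
  ((entrywisePosSemidefOn_gate_sub l).add (.const one_half_pos.le)).congr fun r _ => by ring

lemma entrywisePosSemidefOn_ntkProfile (L : ℕ) :
    EntrywisePosSemidefOn (fun r => ntkProfile L (arccos r)) (Set.Icc (-1) 1) := by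
  induction L with
  | zero => exact entrywisePosSemidefOn_layer 0
  | succ L ih =>
    exact (ih.mul (entrywisePosSemidefOn_gate L)).add (entrywisePosSemidefOn_layer (L + 1))

lemma entrywisePosSemidefOn_ntkProfile_succ_sub (L : ℕ) :
    EntrywisePosSemidefOn
      (fun r => ntkProfile (L + 1) (arccos r) - 1 / 2 * ntkProfile L (arccos r))
      (Set.Icc (-1) 1) :=
  (((entrywisePosSemidefOn_ntkProfile L).mul (entrywisePosSemidefOn_gate_sub L)).add
    (entrywisePosSemidefOn_layer (L + 1))).congr fun r _ => by
      simp only [ntkProfile]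
      ring

/-- All even powers occur with a positive coefficient in the expansion of the tangent kernel in
powers of the cosine, and so does the first power. -/
lemma exists_entrywisePosSemidefOn_ntkProfile_sub (m : ℕ) {L : ℕ} (hL : 1 ≤ L) :
    ∃ c > 0, EntrywisePosSemidefOn
      (fun r => ntkProfile L (arccos r) - c * (r + r ^ (2 * m + 2))) (Set.Icc (-1) 1) := by
  induction L, hL using Nat.le_induction with
  | base =>
    set a : ℝ := invSqrtCoeff m / ((2 * m + 1) * (2 * m + 2)) / π with ha
    have ha0 : 0 < a := by have := invSqrtCoeff_pos m; positivity
    refine ⟨min (1 / 2) a, by positivity, ?_⟩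
    refine (((entrywisePosSemidefOn_ntkProfile 0).mul (entrywisePosSemidefOn_gate 0)).add
      ((entrywisePosSemidefOn_arcCosine_sub m).add
        ((EntrywisePosSemidefOn.id.const_mul (sub_nonneg.2 (min_le_left (1 / 2) a))).add
          ((EntrywisePosSemidefOn.pow (2 * m + 2)).const_mul
            (sub_nonneg.2 (min_le_right (1 / 2) a)))))).congr fun r _ => ?_
    simp only [ntkProfile, zero_add, Function.iterate_one, Function.iterate_zero, _root_.id,
      cos_arcMap (arccos_mem_Icc r), ← ha]
    ring
  | succ L _ ih =>
    obtain ⟨c, hc, h⟩ := ih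
    exact ⟨1 / 2 * c, by positivity, ((entrywisePosSemidefOn_ntkProfile_succ_sub L).add
      (h.const_mul one_half_pos.le)).congr fun r _ => by ring⟩

end EntrywisePosSemidef

section Coercivity

variable {ι E : Type*} [NormedAddCommGroup E] [InnerProductSpace ℝ E] {L : ℕ} {x : ι → E}

/-- The tangent kernel matrix of a family of vectors, as a function of their mutual angles; it is
the matrix of `ntk` when the vectors are of unit length. -/
def profileMatrix (L : ℕ) (x : ι → E) : Matrix ι ι ℝ :=
  Matrix.of fun k l => ntkProfile L (angle (x k) (x l))

lemma angle_eq_arccos_inner {u v : E} (hu : ‖u‖ = 1) (hv : ‖v‖ = 1) :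
    angle u v = arccos (inner ℝ u v) := by
  rw [angle, hu, hv, mul_one, div_one]

lemma inner_mem_Icc {u v : E} (hu : ‖u‖ = 1) (hv : ‖v‖ = 1) :
    inner ℝ u v ∈ Set.Icc (-1 : ℝ) 1 :=
  abs_le.1 (by simpa [hu, hv] using abs_real_inner_le_norm u v)

lemma profileMatrix_eq_map_gram (L : ℕ) (hx : ∀ k, ‖x k‖ = 1) :
    profileMatrix L x = (gram ℝ x).map fun r => ntkProfile L (arccos r) := by
  ext k l
  simp only [profileMatrix, of_apply, map_apply, gram_apply, angle_eq_arccos_inner (hx k) (hx l)]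

lemma isHermitian_profileMatrix (L : ℕ) (x : ι → E) : (profileMatrix L x).IsHermitian := by
  ext k l
  simp [profileMatrix, angle_comm]

lemma posSemidef_profileMatrix [Finite ι] (L : ℕ) (hx : ∀ k, ‖x k‖ = 1) :
    (profileMatrix L x).PosSemidef :=
  profileMatrix_eq_map_gram L hx ▸ (entrywisePosSemidefOn_ntkProfile L).posSemidef_map
    (posSemidef_gram ℝ x) fun k l => inner_mem_Icc (hx k) (hx l)

/-- The vectors `x k`, `k ∈ s`, are at angles at least `δ` from each other and, with the possible
exception of the pair `p, q`, from each other's opposites; `p = q` means no exception. -/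
def AngleSeparatedOn (δ : ℝ) (x : ι → E) (s : Set ι) (p q : ι) : Prop :=
  ∀ k ∈ s, ∀ l ∈ s, k ≠ l →
    δ ≤ angle (x k) (x l) ∧ (angle (x k) (x l) ≤ π - δ ∨ s(k, l) = s(p, q))

lemma isClosed_angleSeparatedOn (δ : ℝ) (s : Set ι) (p q : ι) :
    IsClosed {x : ι → E | (∀ k, ‖x k‖ = 1) ∧ AngleSeparatedOn δ x s p q} := by
  have e : {x : ι → E | (∀ k, ‖x k‖ = 1) ∧ AngleSeparatedOn δ x s p q} =
      {x | (∀ k, ‖x k‖ = 1) ∧ ∀ k ∈ s, ∀ l ∈ s, k ≠ l → δ ≤ arccos (inner ℝ (x k) (x l)) ∧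
        (arccos (inner ℝ (x k) (x l)) ≤ π - δ ∨ s(k, l) = s(p, q))} := by
    ext x
    refine and_congr_right fun hx => ?_
    simp only [AngleSeparatedOn, angle_eq_arccos_inner (hx _) (hx _)]
  rw [e]
  simp only [Set.ofPred_and, Set.ofPred_forall, Set.ofPred_or]
  refine (isClosed_iInter fun k => isClosed_eq (by fun_prop) continuous_const).inter ?_
  refine isClosed_iInter fun k => isClosed_iInter fun _ => isClosed_iInter fun l =>
    isClosed_iInter fun _ => isClosed_iInter fun _ =>
      (isClosed_le continuous_const (by fun_prop)).inter
        ((isClosed_le (by fun_prop) continuous_const).union isClosed_const)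

variable [Fintype ι] {w : ι → ℝ}

lemma sum_smul_eq_zero_and_pow_mulVec_eq_zero (hL : 1 ≤ L) (hx : ∀ k, ‖x k‖ = 1)
    (hw : w ⬝ᵥ profileMatrix L x *ᵥ w ≤ 0) (m : ℕ) :
    ∑ k, w k • x k = 0 ∧ (gram ℝ x).map (· ^ (2 * m + 2)) *ᵥ w = 0 := by
  have hmem : ∀ k l, gram ℝ x k l ∈ Set.Icc (-1 : ℝ) 1 := fun k l => inner_mem_Icc (hx k) (hx l)
  have hG := posSemidef_gram ℝ x
  have hpow := (EntrywisePosSemidefOn.pow (2 * m + 2)).posSemidef_map hG hmem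
  obtain ⟨c, hc, hsub⟩ := exists_entrywisePosSemidefOn_ntkProfile_sub m hL
  have hnn := (hsub.posSemidef_map hG hmem).dotProduct_mulVec_nonneg w
  have e : (gram ℝ x).map (fun r => ntkProfile L (arccos r) - c * (r + r ^ (2 * m + 2))) =
      profileMatrix L x - c • (gram ℝ x + (gram ℝ x).map (· ^ (2 * m + 2))) := by
    rw [profileMatrix_eq_map_gram L hx]
    rfl
  have h1 : 0 ≤ star w ⬝ᵥ gram ℝ x *ᵥ w := hG.dotProduct_mulVec_nonneg w
  have h2 : 0 ≤ star w ⬝ᵥ (gram ℝ x).map (· ^ (2 * m + 2)) *ᵥ w := hpow.dotProduct_mulVec_nonneg w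
  rw [e, sub_mulVec, smul_mulVec, add_mulVec, dotProduct_sub, dotProduct_smul, dotProduct_add,
    smul_eq_mul] at hnn
  have h3 : star w ⬝ᵥ profileMatrix L x *ᵥ w ≤ 0 := hw
  have hsum := nonpos_of_mul_nonpos_right (sub_nonneg.1 hnn |>.trans h3) hc
  refine ⟨?_, (hpow.dotProduct_mulVec_zero_iff w).1 (by linarith)⟩
  rw [← inner_self_eq_zero (𝕜 := ℝ), ← star_dotProduct_gram_mulVec]
  linarith

/-- The even powers of `⟪x k, x l⟫` converge to the indicator of `x k = ± x l`. -/
lemma sum_parallel_eq_zero (hL : 1 ≤ L) (hx : ∀ k, ‖x k‖ = 1)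
    (hw : w ⬝ᵥ profileMatrix L x *ᵥ w ≤ 0) (k : ι) :
    ∑ l, {l | x k = x l ∨ x k = -x l}.indicator w l = 0 := by
  have hlim : ∀ l, Tendsto (fun m : ℕ => inner ℝ (x k) (x l) ^ (2 * m + 2) * w l) atTop
      (𝓝 ({l | x k = x l ∨ x k = -x l}.indicator w l)) := fun l => by
    by_cases h : l ∈ {l | x k = x l ∨ x k = -x l}
    · have h1 : inner ℝ (x k) (x l) ^ 2 = 1 := by
        rcases h with h | h <;> simp [h, hx l]
      rw [Set.indicator_of_mem h]
      refine tendsto_const_nhds.congr fun m => ?_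
      rw [← Nat.mul_succ, pow_mul, h1, one_pow, one_mul]
    · have hlt : inner ℝ (x k) (x l) ^ 2 < 1 := by
        obtain ⟨h1, h2⟩ := inner_mem_Icc (hx k) (hx l)
        have h1' := h1.lt_of_ne' fun e => h <| .inr <|
          (inner_eq_neg_one_iff_of_norm_eq_one (hx k) (hx l)).1 e
        have h2' := h2.lt_of_ne fun e => h <| .inl <|
          (inner_eq_one_iff_of_norm_eq_one (hx k) (hx l)).1 e
        nlinarith
      rw [Set.indicator_of_notMem h]
      have := ((tendsto_pow_atTop_nhds_zero_of_lt_one (sq_nonneg _) hlt).comp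
        (tendsto_add_atTop_nat 1)).mul_const (w l)
      simpa only [Function.comp_def, ← pow_mul, mul_add, mul_one, zero_mul] using this
  refine tendsto_nhds_unique (tendsto_finsetSum _ fun l _ => hlim l)
    (tendsto_const_nhds.congr fun m => ?_)
  exact (congrFun (sum_smul_eq_zero_and_pow_mulVec_eq_zero hL hx hw m).2 k).symm

lemma eq_zero_of_dotProduct_profileMatrix_nonpos (hL : 1 ≤ L) (hx : ∀ k, ‖x k‖ = 1) {p q : ι}
    (hsep : ∀ k l, k ≠ l → w k ≠ 0 → w l ≠ 0 → x k ≠ x l ∧ (x k = -x l → s(k, l) = s(p, q)))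
    (hw : w ⬝ᵥ profileMatrix L x *ᵥ w ≤ 0) : w = 0 := by
  classical
  have hrow := sum_parallel_eq_zero hL hx hw
  have hpartner : ∀ k, w k ≠ 0 → ∃ l, l ≠ k ∧ w l ≠ 0 ∧ x k = -x l := fun k hk => by
    by_contra! hno
    have hsingle : ∑ l, {l | x k = x l ∨ x k = -x l}.indicator w l = w k := by
      rw [Finset.sum_eq_single k (fun l _ hl => ?_) (by simp)]
      · simp
      · by_cases h0 : w l = 0
        · simp [h0]
        · simp [(hsep k l hl.symm hk h0).1, hno l hl h0]
    exact hk (hsingle ▸ hrow k)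
  ext k
  by_contra hk
  obtain ⟨l, hlk, hl, hkl⟩ := hpartner k hk
  have hother : ∀ m, m ≠ k ∧ m ≠ l → w m = 0 := fun m hm => by
    by_contra h0
    obtain ⟨m', hm', hwm', e⟩ := hpartner m h0
    have := ((hsep m m' hm'.symm h0 hwm').2 e).trans ((hsep k l hlk.symm hk hl).2 hkl).symm
    rcases Sym2.eq_iff.1 this with h | h
    exacts [hm.1 h.1, hm.2 h.1]
  have hcancel : w k + w l = 0 := by
    have := hrow k
    rwa [Fintype.sum_eq_add k l hlk.symm fun m hm => by simp [hother m hm],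
      Set.indicator_of_mem (.inl rfl), Set.indicator_of_mem (.inr hkl)] at this
  have hlin := (sum_smul_eq_zero_and_pow_mulVec_eq_zero hL hx hw 0).1
  rw [Fintype.sum_eq_add k l hlk.symm fun m hm => by simp [hother m hm],
    eq_neg_of_add_eq_zero_right hcancel, neg_smul, ← sub_eq_add_neg, ← smul_sub, smul_eq_zero,
    sub_eq_zero] at hlin
  exact hlin.elim hk (hsep k l hlk.symm hk hl).1

variable (ι E) in
/-- Configurations of separated unit vectors together with unit weights carried by `s`. -/
def separatedConfigurations (δ : ℝ) (s : Set ι) (p q : ι) : Set ((ι → E) × (ι → ℝ)) :=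
  {x | (∀ k, ‖x k‖ = 1) ∧ AngleSeparatedOn δ x s p q} ×ˢ
    {w | w ⬝ᵥ w = 1 ∧ ∀ k ∉ s, w k = 0}

lemma isCompact_separatedConfigurations [FiniteDimensional ℝ E] (δ : ℝ) (s : Set ι) (p q : ι) :
    IsCompact (separatedConfigurations ι E δ s p q) := by
  refine IsCompact.prod ?_ ?_
  · exact (isCompact_univ_pi fun _ => isCompact_sphere (0 : E) 1).of_isClosed_subset
      (isClosed_angleSeparatedOn δ s p q) fun x hx k _ => mem_sphere_zero_iff_norm.2 (hx.1 k)
  · refine (isCompact_univ_pi fun _ => isCompact_Icc (a := (-1 : ℝ)) (b := 1)).of_isClosed_subset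
      ?_ fun w hw k _ => abs_le.1 (abs_le_one_iff_mul_self_le_one.2 (hw.1 ▸
        Finset.single_le_sum (fun l _ => mul_self_nonneg (w l)) (Finset.mem_univ k)))
    simp only [Set.ofPred_and, Set.ofPred_forall]
    exact (isClosed_eq (by fun_prop) continuous_const).inter (isClosed_iInter fun k =>
      isClosed_iInter fun _ => isClosed_eq (by fun_prop) continuous_const)

lemma dotProduct_profileMatrix_pos {δ : ℝ} (hL : 1 ≤ L) (hδ : 0 < δ) {s : Set ι} {p q : ι}
    {a : (ι → E) × (ι → ℝ)} (ha : a ∈ separatedConfigurations ι E δ s p q) :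
    0 < a.2 ⬝ᵥ profileMatrix L a.1 *ᵥ a.2 := by
  obtain ⟨⟨hx, hsep⟩, hw1, hw0⟩ := ha
  have hne : a.2 ≠ 0 := fun h => by simp [h] at hw1
  by_contra! hle
  refine hne (eq_zero_of_dotProduct_profileMatrix_nonpos (p := p) (q := q) hL hx
    (fun k l hkl hk hl => ?_) hle)
  obtain ⟨h1, h2⟩ := hsep k (not_imp_comm.1 (hw0 k) hk) l (not_imp_comm.1 (hw0 l) hl) hkl
  have hx0 : ∀ m, a.1 m ≠ 0 := fun m => norm_ne_zero_iff.1 (by simp [hx m])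
  refine ⟨fun e => ?_, fun e => h2.resolve_left fun h2 => ?_⟩
  · rw [e, angle_self (hx0 l)] at h1
    exact hδ.not_ge h1
  · rw [e, angle_neg_left, angle_self (hx0 l)] at h2
    linarith

lemma exists_coercive_on [FiniteDimensional ℝ E] (hL : 1 ≤ L) {δ : ℝ} (hδ : 0 < δ) (s : Set ι)
    (p q : ι) :
    ∃ μ > 0, ∀ x : ι → E, (∀ k, ‖x k‖ = 1) → AngleSeparatedOn δ x s p q →
      ∀ w : ι → ℝ, (∀ k ∉ s, w k = 0) → μ * (w ⬝ᵥ w) ≤ w ⬝ᵥ profileMatrix L x *ᵥ w := by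
  have hcont : ContinuousOn (fun a : (ι → E) × (ι → ℝ) => a.2 ⬝ᵥ profileMatrix L a.1 *ᵥ a.2)
      (separatedConfigurations ι E δ s p q) := by
    have hc := continuous_ntkProfile L
    have e : Set.EqOn (fun a : (ι → E) × (ι → ℝ) => a.2 ⬝ᵥ profileMatrix L a.1 *ᵥ a.2)
        (fun a => ∑ k, ∑ l, a.2 k * a.2 l * ntkProfile L (arccos (inner ℝ (a.1 k) (a.1 l))))
        (separatedConfigurations ι E δ s p q) := fun a ha => by
      simp only [dotProduct_mulVec_eq_sum, profileMatrix_eq_map_gram L ha.1.1, map_apply,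
        gram_apply]
    exact ContinuousOn.congr (by fun_prop) e
  obtain ⟨μ, hμ, h⟩ := (isCompact_separatedConfigurations δ s p q).exists_forall_le' hcont
    fun a ha => dotProduct_profileMatrix_pos hL hδ ha
  refine ⟨μ, hμ, fun x hx hsep w hw => ?_⟩
  rcases eq_or_ne w 0 with rfl | hw0
  · simp
  have hpos : 0 < w ⬝ᵥ w := dotProduct_self_star_pos_iff.2 hw0
  have hsq : √(w ⬝ᵥ w) * √(w ⬝ᵥ w) = w ⬝ᵥ w := mul_self_sqrt hpos.le
  have := h (x, (√(w ⬝ᵥ w))⁻¹ • w) ⟨⟨hx, hsep⟩, ?_, fun k hk => by simp [hw k hk]⟩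
  · simp only [mulVec_smul, dotProduct_smul, smul_dotProduct, smul_eq_mul, ← mul_assoc,
      ← mul_inv, hsq] at this
    rwa [inv_mul_eq_div, le_div_iff₀ hpos] at this
  · simp only [dotProduct_smul, smul_dotProduct, smul_eq_mul, ← mul_assoc, ← mul_inv, hsq]
    exact inv_mul_cancel₀ hpos.ne'

lemma exists_coercive [FiniteDimensional ℝ E] (hL : 1 ≤ L) {δ : ℝ} (hδ : 0 < δ) :
    ∃ μ > 0, ∀ x : ι → E, (∀ k, ‖x k‖ = 1) → ∀ s p q, AngleSeparatedOn δ x s p q →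
      ∀ w : ι → ℝ, (∀ k ∉ s, w k = 0) → μ * (w ⬝ᵥ w) ≤ w ⬝ᵥ profileMatrix L x *ᵥ w := by
  choose μ hμ h using fun s p q => exists_coercive_on (ι := ι) (E := E) hL hδ s p q
  obtain ⟨ν, hν0, hν⟩ : ∃ ν > 0, ∀ s p q, ν ≤ μ s p q := by
    have : ∀ᶠ ν in 𝓝[>] (0 : ℝ), ∀ s p q, ν ≤ μ s p q := by
      simp only [eventually_all]
      exact fun s p q => nhdsWithin_le_nhds (eventually_le_nhds (hμ s p q))
    exact (eventually_mem_nhdsWithin.and this).exists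
  exact ⟨ν, hν0, fun x hx s p q hsep w hw => (mul_le_mul_of_nonneg_right (hν s p q)
    (dotProduct_self_star_nonneg w)).trans (h s p q x hx hsep w hw)⟩

end Coercivity

/-! ### Spectral estimates -/

section Spectral

variable {ι : Type*} [Fintype ι] {S : Matrix ι ι ℝ} {B : ℝ}

section EigenvectorBasis

variable [DecidableEq ι] (hS : S.IsHermitian)

include hS

lemma eigenvectorBasis_dotProduct (e f : ι) :
    (hS.eigenvectorBasis e).ofLp ⬝ᵥ (hS.eigenvectorBasis f).ofLp = if e = f then 1 else 0 := by
  simpa [EuclideanSpace.inner_eq_star_dotProduct, eq_comm] using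
    orthonormal_iff_ite.1 hS.eigenvectorBasis.orthonormal f e

lemma sum_sq_eigenvectorBasis_dotProduct (u : ι → ℝ) :
    ∑ e, ((hS.eigenvectorBasis e).ofLp ⬝ᵥ u) ^ 2 = u ⬝ᵥ u := by
  have h := hS.eigenvectorBasis.sum_sq_inner_left (WithLp.toLp 2 u)
  rw [EuclideanSpace.real_norm_sq_eq] at h
  simpa [EuclideanSpace.inner_eq_star_dotProduct, dotProduct, sq] using h

lemma dotProduct_mulVec_eq_sum_eigenvalues (u : ι → ℝ) :
    u ⬝ᵥ S *ᵥ u = ∑ e, hS.eigenvalues e * ((hS.eigenvectorBasis e).ofLp ⬝ᵥ u) ^ 2 := by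
  have h := hS.eigenvectorBasis.sum_inner_mul_inner (WithLp.toLp 2 u) (WithLp.toLp 2 (S *ᵥ u))
  simp only [EuclideanSpace.inner_eq_star_dotProduct, star_trivial] at h
  rw [dotProduct_comm, ← h]
  refine Finset.sum_congr rfl fun e _ => ?_
  rw [dotProduct_comm (S *ᵥ u), dotProduct_mulVec, ← mulVec_transpose,
    show Sᵀ = S from hS, hS.mulVec_eigenvectorBasis, smul_dotProduct, smul_eq_mul]
  ring

lemma finrank_le_card_eigenvalues_le {W : Submodule ℝ (ι → ℝ)}
    (hW : ∀ u ∈ W, u ⬝ᵥ S *ᵥ u ≤ B * (u ⬝ᵥ u)) :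
    Module.finrank ℝ W ≤ Fintype.card {e // hS.eigenvalues e ≤ B} := by
  by_contra! h
  let coords : W →ₗ[ℝ] {e // hS.eigenvalues e ≤ B} → ℝ :=
    (LinearMap.pi fun e => dotProductBilin ℝ ℝ (hS.eigenvectorBasis e.1).ofLp) ∘ₗ W.subtype
  obtain ⟨⟨u, huW⟩, hu, hu0⟩ :=
    (Submodule.ne_bot_iff _).1 (LinearMap.ker_ne_bot_of_finrank_lt (f := coords) (by simpa using h))
  have hcoord : ∀ e, hS.eigenvalues e ≤ B → (hS.eigenvectorBasis e).ofLp ⬝ᵥ u = 0 := fun e he =>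
    congrFun (LinearMap.mem_ker.1 hu) ⟨e, he⟩
  have hne : u ⬝ᵥ u ≠ 0 := fun h0 => hu0 (Subtype.ext (dotProduct_self_eq_zero.1 h0))
  obtain ⟨e, -, he⟩ := Finset.exists_ne_zero_of_sum_ne_zero
    ((sum_sq_eigenvectorBasis_dotProduct hS u).trans_ne hne)
  refine (hW u huW).not_gt ?_
  rw [dotProduct_mulVec_eq_sum_eigenvalues hS, ← sum_sq_eigenvectorBasis_dotProduct hS,
    Finset.mul_sum]
  refine Finset.sum_lt_sum (fun f _ => ?_) ⟨e, Finset.mem_univ e, ?_⟩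
  · rcases le_or_gt (hS.eigenvalues f) B with hf | hf
    · simp [hcoord f hf]
    · gcongr
  · have heB : B < hS.eigenvalues e := lt_of_not_ge fun hle => he (by simp [hcoord e hle])
    exact mul_lt_mul_of_pos_right heB (lt_of_le_of_ne (sq_nonneg _) (Ne.symm he))

end EigenvectorBasis

lemma exists_eigenvector_of_rayleigh (hS : S.PosSemidef) {u : ι → ℝ} (hu : u ≠ 0)
    (hB : u ⬝ᵥ S *ᵥ u ≤ B * (u ⬝ᵥ u)) :
    ∃ (lam : ℝ) (v : ι → ℝ), 0 ≤ lam ∧ lam ≤ B ∧ v ⬝ᵥ v = 1 ∧ S *ᵥ v = lam • v := by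
  classical
  have hW : ∀ w ∈ ℝ ∙ u, w ⬝ᵥ S *ᵥ w ≤ B * (w ⬝ᵥ w) := by
    intro w hw
    obtain ⟨r, rfl⟩ := Submodule.mem_span_singleton.1 hw
    simp only [mulVec_smul, smul_dotProduct, dotProduct_smul, smul_eq_mul]
    linarith [mul_le_mul_of_nonneg_left hB (mul_self_nonneg r)]
  have hcard := finrank_le_card_eigenvalues_le hS.isHermitian hW
  rw [finrank_span_singleton hu] at hcard
  obtain ⟨e, he⟩ := Fintype.card_pos_iff.1 hcard
  exact ⟨_, _, hS.eigenvalues_nonneg e, he,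
    by simpa using eigenvectorBasis_dotProduct hS.isHermitian e e,
    hS.isHermitian.mulVec_eigenvectorBasis e⟩

lemma exists_unit_orthogonal_pair (a b : ℝ) :
    ∃ α β : ℝ, α ^ 2 + β ^ 2 = 1 ∧ α * a + β * b = 0 := by
  have hre : ‖(⟨b, -a⟩ : ℂ)‖ * cos (Complex.arg ⟨b, -a⟩) = b := Complex.norm_mul_cos_arg _
  have him : ‖(⟨b, -a⟩ : ℂ)‖ * sin (Complex.arg ⟨b, -a⟩) = -a := Complex.norm_mul_sin_arg _
  refine ⟨_, _, cos_sq_add_sin_sq (Complex.arg ⟨b, -a⟩), ?_⟩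
  linear_combination cos (Complex.arg ⟨b, -a⟩) * him - sin (Complex.arg ⟨b, -a⟩) * hre

lemma exists_eigenvector_of_plane (hS : S.PosSemidef) {W : Submodule ℝ (ι → ℝ)}
    (hdim : 2 ≤ Module.finrank ℝ W) (hW : ∀ u ∈ W, u ⬝ᵥ S *ᵥ u ≤ B * (u ⬝ᵥ u))
    (f : (ι → ℝ) →ₗ[ℝ] ℝ) :
    ∃ (lam : ℝ) (v u : ι → ℝ), 0 ≤ lam ∧ lam ≤ B ∧ v ⬝ᵥ v = 1 ∧ S *ᵥ v = lam • v ∧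
      u ⬝ᵥ u = 1 ∧ f u = 0 ∧ S *ᵥ u ⬝ᵥ S *ᵥ u ≤ lam ^ 2 := by
  classical
  have hS' := hS.isHermitian
  obtain ⟨e, e₀, hB, hle, hne⟩ : ∃ e e₀, hS'.eigenvalues e ≤ B ∧
      hS'.eigenvalues e₀ ≤ hS'.eigenvalues e ∧ e ≠ e₀ := by
    obtain ⟨⟨p, hp⟩, ⟨q, hq⟩, hpq⟩ :=
      Fintype.one_lt_card_iff.1 (hdim.trans (finrank_le_card_eigenvalues_le hS' hW))
    have hpq' : p ≠ q := fun h => hpq (Subtype.ext h)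
    rcases le_total (hS'.eigenvalues q) (hS'.eigenvalues p) with h | h
    exacts [⟨p, q, hp, h, hpq'⟩, ⟨q, p, hq, h, hpq'.symm⟩]
  set v := (hS'.eigenvectorBasis e).ofLp
  set v₀ := (hS'.eigenvectorBasis e₀).ofLp
  have hv : v ⬝ᵥ v = 1 := by simpa using eigenvectorBasis_dotProduct hS' e e
  have hv₀ : v₀ ⬝ᵥ v₀ = 1 := by simpa using eigenvectorBasis_dotProduct hS' e₀ e₀
  have hvv₀ : v ⬝ᵥ v₀ = 0 := by simpa [hne] using eigenvectorBasis_dotProduct hS' e e₀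
  have hSv : S *ᵥ v = hS'.eigenvalues e • v := hS'.mulVec_eigenvectorBasis e
  have hSv₀ : S *ᵥ v₀ = hS'.eigenvalues e₀ • v₀ := hS'.mulVec_eigenvectorBasis e₀
  obtain ⟨α, β, hαβ, hf⟩ := exists_unit_orthogonal_pair (f v) (f v₀)
  refine ⟨_, v, α • v + β • v₀, hS.eigenvalues_nonneg e, hB, hv, hSv, ?_, by simpa using hf, ?_⟩
  · simp only [dotProduct_add, add_dotProduct, smul_dotProduct, dotProduct_smul, smul_eq_mul, hv,
      hv₀, hvv₀, dotProduct_comm v₀ v]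
    linarith
  · simp only [mulVec_add, mulVec_smul, hSv, hSv₀, dotProduct_add, add_dotProduct, smul_dotProduct,
      dotProduct_smul, smul_eq_mul, hv, hv₀, hvv₀, dotProduct_comm v₀ v]
    have hsq : hS'.eigenvalues e₀ ^ 2 ≤ hS'.eigenvalues e ^ 2 :=
      pow_le_pow_left₀ (hS.eigenvalues_nonneg e₀) hle 2
    linear_combination β ^ 2 * hsq + hS'.eigenvalues e ^ 2 * hαβ

end Spectral

/-! ### The dual estimate -/

section DipoleEstimate

variable {ι : Type*}

lemma abs_sign_mul_le (s t : ℝ) : |(SignType.sign s : ℝ) * t| ≤ |t| := by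
  rw [abs_mul]
  exact mul_le_of_le_one_left (abs_nonneg t) (by cases SignType.sign s <;> simp)

lemma sum_mul_abs_le_of_dominant [DecidableEq ι] {s : Finset ι} {D : Matrix ι ι ℝ} {a w : ι → ℝ}
    {γ : ℝ} (hD : ∀ l ∈ s, γ * a l + ∑ k ∈ s.erase l, |D k l| ≤ D l l) :
    γ * ∑ l ∈ s, a l * |w l| ≤ ∑ k ∈ s, |∑ l ∈ s, D k l * w l| := by
  have hcol : ∀ l ∈ s, γ * (a l * |w l|) ≤ ∑ k ∈ s, SignType.sign (w k) * (D k l * w l) := by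
    intro l hl
    have hoff : ∀ k ∈ s.erase l, -(|D k l| * |w l|) ≤ SignType.sign (w k) * (D k l * w l) := by
      intro k _
      rw [← abs_mul]
      exact (abs_le.1 (abs_sign_mul_le _ _)).1
    rw [← Finset.add_sum_erase s _ hl]
    have hsum := Finset.sum_le_sum hoff
    rw [Finset.sum_neg_distrib, ← Finset.sum_mul] at hsum
    have hdiag : (SignType.sign (w l) : ℝ) * (D l l * w l) = D l l * |w l| := by
      rw [mul_left_comm, sign_mul_self]
    have := mul_le_mul_of_nonneg_right (hD l hl) (abs_nonneg (w l))
    linarith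
  rw [Finset.mul_sum]
  calc ∑ l ∈ s, γ * (a l * |w l|)
      ≤ ∑ l ∈ s, ∑ k ∈ s, SignType.sign (w k) * (D k l * w l) := Finset.sum_le_sum hcol
    _ = ∑ k ∈ s, SignType.sign (w k) * ∑ l ∈ s, D k l * w l := by
      rw [Finset.sum_comm]
      simp only [Finset.mul_sum]
    _ ≤ ∑ k ∈ s, |∑ l ∈ s, D k l * w l| := by
      gcongr with k
      exact (le_abs_self _).trans (abs_sign_mul_le _ _)

/-- The matrix of the form `K` on the dipoles `e k - e r` with base point `r`. -/
def dipoleMatrix (K : Matrix ι ι ℝ) (r : ι) : Matrix ι ι ℝ :=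
  Matrix.of fun k l => K k l - K r l - (K k r - K r r)

/-- The weights `w` with those on `s` moved to `r`: what remains of `w` after splitting off the
dipoles `e k - e r`, `k ∈ s`. -/
def mergeWeights [DecidableEq ι] (s : Finset ι) (r : ι) (w : ι → ℝ) : ι → ℝ :=
  w - ∑ k ∈ s, w k • (Pi.single k 1 - Pi.single r 1)

lemma mergeWeights_apply_of_mem [DecidableEq ι] {s : Finset ι} {r k : ι} (hr : r ∉ s)
    (hk : k ∈ s) (w : ι → ℝ) : mergeWeights s r w k = 0 := by
  have hkr : k ≠ r := fun h => hr (h ▸ hk)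
  simp [mergeWeights, Pi.single_apply, hkr, hk]

variable [Fintype ι]

lemma abs_dotProduct_le_mul_sum_abs {u w : ι → ℝ} {B : ℝ} (h : ∀ k, |u k| ≤ B) :
    |u ⬝ᵥ w| ≤ B * ∑ k, |w k| := by
  rw [dotProduct, Finset.mul_sum]
  refine (Finset.abs_sum_le_sum_abs _ _).trans (Finset.sum_le_sum fun k _ => ?_)
  rw [abs_mul]
  gcongr
  exact h k

lemma sum_abs_le_of_coercive {K : Matrix ι ι ℝ} {w : ι → ℝ} {μ B : ℝ} (hμ : 0 < μ)
    (hB : ∀ k, |(K *ᵥ w) k| ≤ B) (hc : μ * (w ⬝ᵥ w) ≤ w ⬝ᵥ K *ᵥ w) :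
    ∑ k, |w k| ≤ Fintype.card ι / μ * B := by
  have hT : 0 ≤ ∑ k, |w k| := Finset.sum_nonneg fun k _ => abs_nonneg _
  have hsq : (∑ k, |w k|) * ∑ k, |w k| ≤ Fintype.card ι * (w ⬝ᵥ w) := by
    simpa [dotProduct, sq, ← abs_mul] using
      sq_sum_le_card_mul_sum_sq (s := Finset.univ) (f := fun k => |w k|)
  have hform : μ * (w ⬝ᵥ w) ≤ B * ∑ k, |w k| := by
    rw [dotProduct_comm w (K *ᵥ w)] at hc
    exact hc.trans ((le_abs_self _).trans (abs_dotProduct_le_mul_sum_abs hB))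
  rcases hT.eq_or_lt with h0 | h0
  · rcases isEmpty_or_nonempty ι with _ | ⟨⟨k⟩⟩
    · simp
    · have := (abs_nonneg _).trans (hB k)
      rw [← h0]
      positivity
  · refine le_of_mul_le_mul_right ?_ h0
    calc (∑ k, |w k|) * ∑ k, |w k| ≤ Fintype.card ι / μ * (μ * (w ⬝ᵥ w)) := by
          rwa [← mul_assoc, div_mul_cancel₀ _ hμ.ne']
      _ ≤ Fintype.card ι / μ * (B * ∑ k, |w k|) := by gcongr
      _ = Fintype.card ι / μ * B * ∑ k, |w k| := (mul_assoc _ _ _).symm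

variable [DecidableEq ι]

lemma mergeWeights_dotProduct (s : Finset ι) (r : ι) (w z : ι → ℝ) :
    mergeWeights s r w ⬝ᵥ z = w ⬝ᵥ z - ∑ k ∈ s, w k * (z k - z r) := by
  simp [mergeWeights, sub_dotProduct, sum_dotProduct]

lemma mulVec_sub_mulVec_eq (K : Matrix ι ι ℝ) (s : Finset ι) (r : ι) (w : ι → ℝ) (k : ι) :
    (K *ᵥ w) k - (K *ᵥ w) r =
      (K k - K r) ⬝ᵥ mergeWeights s r w + ∑ l ∈ s, dipoleMatrix K r k l * w l := by
  rw [dotProduct_comm, mergeWeights_dotProduct, dotProduct_comm, sub_dotProduct]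
  simp only [mulVec, dipoleMatrix, of_apply, Pi.sub_apply, mul_comm (w _)]
  ring

variable {K : Matrix ι ι ℝ} {s : Finset ι} {r : ι} {a w : ι → ℝ} {γ μ Λ F : ℝ}

lemma sum_abs_mergeWeights_le (hK : K.IsSymm) (hμ : 0 < μ)
    (hlip : ∀ k ∈ s, ∀ m, |K k m - K r m| ≤ Λ * a k)
    (hcoer : μ * (mergeWeights s r w ⬝ᵥ mergeWeights s r w) ≤
      mergeWeights s r w ⬝ᵥ K *ᵥ mergeWeights s r w)
    (hF : ∀ k, |(K *ᵥ w) k| ≤ F) :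
    ∑ k, |mergeWeights s r w k| ≤
      Fintype.card ι / μ * (F + Λ * ∑ k ∈ s, a k * |w k|) := by
  refine sum_abs_le_of_coercive hμ (fun m => ?_) hcoer
  have hm : (K *ᵥ mergeWeights s r w) m = (K *ᵥ w) m - ∑ k ∈ s, w k * (K k m - K r m) := by
    rw [mulVec, dotProduct_comm, mergeWeights_dotProduct, dotProduct_comm]
    simp only [mulVec, hK.apply m]
  rw [hm, Finset.mul_sum]
  refine (abs_sub _ _).trans (add_le_add (hF m) ((Finset.abs_sum_le_sum_abs _ _).trans ?_))
  refine Finset.sum_le_sum fun k hk => ?_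
  rw [abs_mul]
  linarith [mul_le_mul_of_nonneg_left (hlip k hk m) (abs_nonneg (w k))]

lemma sum_mul_abs_le_of_dominant_dipoles
    (hlip : ∀ k ∈ s, ∀ m, |K k m - K r m| ≤ Λ * a k)
    (hdom : ∀ l ∈ s, γ * a l + ∑ k ∈ s.erase l, |dipoleMatrix K r k l| ≤ dipoleMatrix K r l l)
    (hF : ∀ k, |(K *ᵥ w) k| ≤ F) :
    γ * ∑ k ∈ s, a k * |w k| ≤
      2 * Fintype.card ι * F + Λ * (∑ k ∈ s, a k) * ∑ k, |mergeWeights s r w k| := by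
  have hF0 : 0 ≤ F := (abs_nonneg _).trans (hF r)
  have hrow : ∀ k ∈ s, |∑ l ∈ s, dipoleMatrix K r k l * w l| ≤
      2 * F + Λ * a k * ∑ m, |mergeWeights s r w m| := by
    intro k hk
    rw [← sub_eq_of_eq_add' (mulVec_sub_mulVec_eq K s r w k)]
    refine (abs_sub _ _).trans (add_le_add ?_ (abs_dotProduct_le_mul_sum_abs (hlip k hk)))
    exact (abs_sub _ _).trans (by linarith [hF k, hF r])
  calc γ * ∑ k ∈ s, a k * |w k|
      ≤ ∑ k ∈ s, |∑ l ∈ s, dipoleMatrix K r k l * w l| := sum_mul_abs_le_of_dominant hdom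
    _ ≤ ∑ k ∈ s, (2 * F + Λ * a k * ∑ m, |mergeWeights s r w m|) := Finset.sum_le_sum hrow
    _ = s.card * (2 * F) + Λ * (∑ k ∈ s, a k) * ∑ m, |mergeWeights s r w m| := by
      rw [Finset.sum_add_distrib, Finset.sum_const, nsmul_eq_mul, ← Finset.sum_mul,
        ← Finset.mul_sum]
    _ ≤ 2 * Fintype.card ι * F + Λ * (∑ k ∈ s, a k) * ∑ k, |mergeWeights s r w k| := by
      have hcard : (s.card : ℝ) ≤ Fintype.card ι := by exact_mod_cast s.card_le_univ
      linarith [mul_le_mul_of_nonneg_right hcard hF0]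

lemma sum_mul_abs_le_of_dominant_dipoles_of_coercive (hK : K.IsSymm) (hμ : 0 < μ) (hγ : 0 < γ)
    (hΛ : 1 ≤ Λ) (ha : ∀ k ∈ s, 0 ≤ a k)
    (hlip : ∀ k ∈ s, ∀ m, |K k m - K r m| ≤ Λ * a k)
    (hdom : ∀ l ∈ s, γ * a l + ∑ k ∈ s.erase l, |dipoleMatrix K r k l| ≤ dipoleMatrix K r l l)
    (hcoer : μ * (mergeWeights s r w ⬝ᵥ mergeWeights s r w) ≤
      mergeWeights s r w ⬝ᵥ K *ᵥ mergeWeights s r w)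
    (hsmall : 2 * Λ ^ 2 * (∑ k ∈ s, a k) * (Fintype.card ι / μ) ≤ γ)
    (hF : ∀ k, |(K *ᵥ w) k| ≤ F) :
    ∑ k ∈ s, a k * |w k| ≤ (4 * Fintype.card ι / γ + 1) * F := by
  have hF0 : 0 ≤ F := (abs_nonneg _).trans (hF r)
  have hT := sum_abs_mergeWeights_le hK hμ hlip hcoer hF
  have hV := sum_mul_abs_le_of_dominant_dipoles hlip hdom hF
  set ν : ℝ := Fintype.card ι / μ
  set T := ∑ k, |mergeWeights s r w k|
  set V := ∑ k ∈ s, a k * |w k|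
  set D := ∑ k ∈ s, a k
  have hD0 : 0 ≤ D := Finset.sum_nonneg ha
  have hV0 : 0 ≤ V := Finset.sum_nonneg fun k hk => mul_nonneg (ha k hk) (abs_nonneg _)
  have hν0 : 0 ≤ ν := by positivity
  have hDT : Λ * D * T ≤ γ / 2 * F + γ / 2 * V := calc
    Λ * D * T ≤ Λ * D * (ν * (F + Λ * V)) := by gcongr
    _ = Λ * D * ν * F + Λ ^ 2 * D * ν * V := by ring
    _ ≤ Λ ^ 2 * D * ν * F + Λ ^ 2 * D * ν * V := by
      gcongr
      exact le_self_pow₀ hΛ two_ne_zero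
    _ ≤ γ / 2 * F + γ / 2 * V := by gcongr <;> linarith
  refine le_of_mul_le_mul_left ?_ (half_pos hγ)
  calc γ / 2 * V ≤ 2 * Fintype.card ι * F + γ / 2 * F := by linarith
    _ = γ / 2 * ((4 * Fintype.card ι / γ + 1) * F) := by field_simp; ring

lemma abs_dotProduct_le_of_dominant_dipoles (hK : K.IsSymm) (hμ : 0 < μ) (hγ : 0 < γ)
    (hΛ : 1 ≤ Λ) (ha : ∀ k ∈ s, 0 ≤ a k)
    (hlip : ∀ k ∈ s, ∀ m, |K k m - K r m| ≤ Λ * a k)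
    (hdom : ∀ l ∈ s, γ * a l + ∑ k ∈ s.erase l, |dipoleMatrix K r k l| ≤ dipoleMatrix K r l l)
    (hcoer : μ * (mergeWeights s r w ⬝ᵥ mergeWeights s r w) ≤
      mergeWeights s r w ⬝ᵥ K *ᵥ mergeWeights s r w)
    (hsmall : 2 * Λ ^ 2 * (∑ k ∈ s, a k) * (Fintype.card ι / μ) ≤ γ)
    (hF : ∀ k, |(K *ᵥ w) k| ≤ F) {y : ι → ℝ} {A : ℝ} (hyA : ∀ k, |y k| ≤ A)
    (hya : ∀ k ∈ s, |y k - y r| ≤ A * a k) :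
    |w ⬝ᵥ y| ≤ (Fintype.card ι / μ * (1 + Λ * (4 * Fintype.card ι / γ + 1)) +
      (4 * Fintype.card ι / γ + 1)) * A * F := by
  have hF0 : 0 ≤ F := (abs_nonneg _).trans (hF r)
  have hA0 : 0 ≤ A := (abs_nonneg _).trans (hyA r)
  have hT := sum_abs_mergeWeights_le hK hμ hlip hcoer hF
  have hV := sum_mul_abs_le_of_dominant_dipoles_of_coercive hK hμ hγ hΛ ha hlip hdom hcoer hsmall hF
  set ν : ℝ := Fintype.card ι / μ
  set R : ℝ := 4 * Fintype.card ι / γ + 1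
  set T := ∑ k, |mergeWeights s r w k|
  set V := ∑ k ∈ s, a k * |w k|
  have hν0 : 0 ≤ ν := by positivity
  have hwy : w ⬝ᵥ y = mergeWeights s r w ⬝ᵥ y + ∑ k ∈ s, w k * (y k - y r) := by
    rw [mergeWeights_dotProduct, sub_add_cancel]
  have hmerged : |mergeWeights s r w ⬝ᵥ y| ≤ A * T := by
    rw [dotProduct_comm]
    exact abs_dotProduct_le_mul_sum_abs hyA
  have hdipoles : |∑ k ∈ s, w k * (y k - y r)| ≤ A * V := by
    rw [Finset.mul_sum]
    refine (Finset.abs_sum_le_sum_abs _ _).trans (Finset.sum_le_sum fun k hk => ?_)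
    rw [abs_mul]
    linarith [mul_le_mul_of_nonneg_left (hya k hk) (abs_nonneg (w k))]
  calc |w ⬝ᵥ y| ≤ A * T + A * V := hwy ▸ (abs_add_le _ _).trans (add_le_add hmerged hdipoles)
    _ ≤ A * (ν * (F + Λ * (R * F))) + A * (R * F) := by
      gcongr
      exact hT.trans (by gcongr)
    _ = (ν * (1 + Λ * R) + R) * A * F := by ring

end DipoleEstimate

section Geometry

variable {ι E : Type*} [NormedAddCommGroup E] [InnerProductSpace ℝ E] {L : ℕ} {x : ι → E}

lemma norm_sub_eq_two_mul_sin {u v : E} (hu : ‖u‖ = 1) (hv : ‖v‖ = 1) :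
    ‖u - v‖ = 2 * sin (angle u v / 2) := by
  have hsin : 0 ≤ sin (angle u v / 2) :=
    sin_nonneg_of_nonneg_of_le_pi (by linarith [angle_nonneg u v])
      (by linarith [angle_le_pi u v, angle_nonneg u v])
  rw [← pow_left_inj₀ (norm_nonneg _) (by positivity) two_ne_zero, norm_sub_sq_real, hu, hv,
    ← cos_angle_mul_norm_mul_norm, hu, hv, mul_pow, sin_sq_eq_half_sub,
    mul_div_cancel₀ _ (two_ne_zero' ℝ)]
  ring

lemma norm_sub_le_angle {u v : E} (hu : ‖u‖ = 1) (hv : ‖v‖ = 1) : ‖u - v‖ ≤ angle u v := by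
  rw [norm_sub_eq_two_mul_sin hu hv]
  have := sin_le (x := angle u v / 2) (by linarith [angle_nonneg u v])
  linarith

lemma angle_le_norm_sub {u v : E} (hu : ‖u‖ = 1) (hv : ‖v‖ = 1) :
    angle u v ≤ π / 2 * ‖u - v‖ := by
  rw [norm_sub_eq_two_mul_sin hu hv]
  have := mul_le_sin (x := angle u v / 2) (by linarith [angle_nonneg u v])
    (by linarith [angle_le_pi u v])
  have h := mul_le_mul_of_nonneg_left this pi_nonneg
  rw [← mul_assoc, mul_div_cancel₀ _ pi_ne_zero] at h
  linarith

lemma abs_angle_sub_angle_le (u v t : E) : |angle u t - angle v t| ≤ angle u v := by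
  have h₁ := angle_le_angle_add_angle u v t
  have h₂ := angle_le_angle_add_angle v u t
  rw [angle_comm v u] at h₂
  exact abs_sub_le_iff.2 ⟨by linarith, by linarith⟩

lemma profileMatrix_self (L : ℕ) (hx : ∀ k, ‖x k‖ = 1) (k : ι) :
    profileMatrix L x k k = ntkProfile L 0 := by
  rw [profileMatrix, of_apply, angle_self (norm_ne_zero_iff.1 (by simp [hx k]))]

lemma exists_abs_profileMatrix_sub_le (L : ℕ) :
    ∃ Λ : ℝ, 1 ≤ Λ ∧ ∀ (x : ι → E) (k l m : ι),
      |profileMatrix L x k m - profileMatrix L x l m| ≤ Λ * angle (x k) (x l) := by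
  obtain ⟨κ, hκ⟩ := exists_lipschitzOnWith_ntkProfile L
  refine ⟨κ + 1, le_add_of_nonneg_left κ.2, fun x k l m => ?_⟩
  calc |profileMatrix L x k m - profileMatrix L x l m|
      ≤ κ * |angle (x k) (x m) - angle (x l) (x m)| :=
        hκ.dist_le_mul _ (angle_mem_Icc _ _) _ (angle_mem_Icc _ _)
    _ ≤ (κ + 1) * angle (x k) (x l) := by
        gcongr
        · linarith
        · exact abs_angle_sub_angle_le _ _ _

end Geometry

section DualBound

variable {ι E : Type*} [NormedAddCommGroup E] [InnerProductSpace ℝ E] {L : ℕ} {x : ι → E}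

lemma abs_dipoleMatrix_profileMatrix_le (hx : ∀ k, ‖x k‖ = 1) {c η : ℝ} (hc : 0 < c)
    (hslope : ∀ s t, 0 ≤ s → s ≤ t → t ≤ η →
      9 / 10 * c * (t - s) ≤ ntkProfile L s - ntkProfile L t ∧
        ntkProfile L s - ntkProfile L t ≤ 11 / 10 * c * (t - s))
    {p q r : ι} (hp : angle (x p) (x r) ≤ angle (x p) (x q))
    (hq : angle (x q) (x r) ≤ angle (x p) (x q)) (hpq : angle (x p) (x q) ≤ η) :
    |dipoleMatrix (profileMatrix L x) r p q| ≤ 11 / 10 * c * angle (x p) (x r) := by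
  have e : dipoleMatrix (profileMatrix L x) r p q =
      (ntkProfile L 0 - ntkProfile L (angle (x p) (x r))) -
        (ntkProfile L (angle (x q) (x r)) - ntkProfile L (angle (x p) (x q))) := by
    rw [dipoleMatrix, of_apply, profileMatrix_self L hx]
    simp only [profileMatrix, of_apply, angle_comm (x r)]
    ring
  obtain ⟨h₁, h₂⟩ := hslope 0 _ le_rfl (angle_nonneg (x p) (x r)) (hp.trans hpq)
  obtain ⟨h₃, h₄⟩ := hslope _ _ (angle_nonneg (x q) (x r)) hq hpq
  have htri := angle_le_angle_add_angle (x p) (x r) (x q)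
  rw [angle_comm (x r)] at htri
  have hpr : 0 ≤ c * angle (x p) (x r) := mul_nonneg hc.le (angle_nonneg _ _)
  have hpq : 0 ≤ c * (angle (x p) (x q) - angle (x q) (x r)) := mul_nonneg hc.le (sub_nonneg.2 hq)
  have hle : c * (angle (x p) (x q) - angle (x q) (x r)) ≤ c * angle (x p) (x r) := by
    gcongr
    linarith
  rw [e, abs_le]
  constructor <;> linarith

lemma le_dipoleMatrix_profileMatrix_self (hx : ∀ k, ‖x k‖ = 1) {c η : ℝ}
    (hslope : ∀ s t, 0 ≤ s → s ≤ t → t ≤ η →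
      9 / 10 * c * (t - s) ≤ ntkProfile L s - ntkProfile L t)
    {p r : ι} (hp : angle (x p) (x r) ≤ η) :
    18 / 10 * c * angle (x p) (x r) ≤ dipoleMatrix (profileMatrix L x) r p p := by
  have h := hslope 0 _ le_rfl (angle_nonneg (x p) (x r)) hp
  rw [dipoleMatrix, of_apply, profileMatrix_self L hx, profileMatrix_self L hx]
  simp only [profileMatrix, of_apply, angle_comm (x r)]
  linarith

/-- In a cluster whose base point `r` lies opposite its longest side, the form of the kernel on the
dipoles is diagonally dominant. -/
lemma dipoleMatrix_profileMatrix_dominant [DecidableEq ι] (hx : ∀ k, ‖x k‖ = 1) {c η : ℝ}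
    (hc : 0 < c)
    (hslope : ∀ s t, 0 ≤ s → s ≤ t → t ≤ η →
      9 / 10 * c * (t - s) ≤ ntkProfile L s - ntkProfile L t ∧
        ntkProfile L s - ntkProfile L t ≤ 11 / 10 * c * (t - s))
    {s : Finset ι} {r : ι} (hs : s.card ≤ 2)
    (hapex : ∀ k ∈ s, ∀ l ∈ s, k ≠ l → angle (x k) (x r) ≤ angle (x k) (x l))
    (hclose : ∀ k ∈ s, angle (x k) (x r) ≤ η / 2) {l : ι} (hl : l ∈ s) :
    7 / 10 * c * angle (x l) (x r) +
        ∑ k ∈ s.erase l, |dipoleMatrix (profileMatrix L x) r k l| ≤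
      dipoleMatrix (profileMatrix L x) r l l := by
  have hsymm : ∀ k, dipoleMatrix (profileMatrix L x) r k l =
      dipoleMatrix (profileMatrix L x) r l k := fun k => by
    simp only [dipoleMatrix, profileMatrix, of_apply, angle_comm]
    ring
  have hoff : ∀ k ∈ s.erase l,
      |dipoleMatrix (profileMatrix L x) r k l| ≤ 11 / 10 * c * angle (x l) (x r) := fun k hk => by
    obtain ⟨hkl, hk⟩ := Finset.mem_erase.1 hk
    have htri := angle_le_angle_add_angle (x l) (x r) (x k)
    rw [angle_comm (x r)] at htri
    rw [hsymm]
    refine abs_dipoleMatrix_profileMatrix_le hx hc hslope (hapex l hl k hk hkl.symm) ?_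
      (by linarith [hclose k hk, hclose l hl])
    rw [angle_comm (x l) (x k)]
    exact hapex k hk l hl hkl
  have hl0 : 0 ≤ angle (x l) (x r) := angle_nonneg _ _
  have hsum : ∑ k ∈ s.erase l, |dipoleMatrix (profileMatrix L x) r k l| ≤
      11 / 10 * c * angle (x l) (x r) := by
    have hcard : ((s.erase l).card : ℝ) ≤ 1 := by
      have := Finset.card_erase_of_mem hl
      exact_mod_cast (by omega : (s.erase l).card ≤ 1)
    refine (Finset.sum_le_card_nsmul _ _ _ hoff).trans ?_
    rw [nsmul_eq_mul]
    exact mul_le_of_le_one_left (by positivity) hcard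
  have hdiag := le_dipoleMatrix_profileMatrix_self hx (fun s t h₀ h₁ h₂ => (hslope s t h₀ h₁ h₂).1)
    (p := l) (r := r) (by linarith [hclose l hl])
  linarith

lemma exists_apex [DecidableEq ι] {D : ι → ι → ℝ} (hD : ∀ k l, D k l = D l k) (i j k : ι) :
    ∃ r ∈ ({i, j, k} : Finset ι), ∀ a ∈ ({i, j, k} : Finset ι).erase r,
      ∀ b ∈ ({i, j, k} : Finset ι).erase r, a ≠ b → D a r ≤ D a b := by
  simp only [Finset.mem_erase, Finset.mem_insert, Finset.mem_singleton]
  by_cases hi : D i j ≤ D j k ∧ D i k ≤ D j k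
  · exact ⟨i, by grind⟩
  by_cases hj : D i j ≤ D i k ∧ D j k ≤ D i k
  · exact ⟨j, by grind⟩
  · exact ⟨k, by grind⟩

lemma angle_mem_Icc_of_angle_le {u v t : E} {δ : ℝ} (huv : angle u v ≤ δ / 2)
    (hv : angle v t ∈ Set.Icc δ (π - δ)) : angle u t ∈ Set.Icc (δ / 2) (π - δ / 2) := by
  have := abs_le.1 (abs_angle_sub_angle_le u v t)
  exact ⟨by linarith [hv.1], by linarith [hv.2]⟩

lemma AngleSeparatedOn.of_close [DecidableEq ι] {δ : ℝ} (hδ : 0 ≤ δ) {i j k r : ι} (hki : k ≠ i)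
    (hkj : k ≠ j) (hsep : ({i, j}ᶜ : Set ι).Pairwise fun k l =>
      angle (x k) (x l) ∈ Set.Icc δ (π - δ))
    (hrk : angle (x r) (x k) ≤ δ / 2) (p : ι) :
    AngleSeparatedOn (δ / 2) x ((({i, j, k} : Finset ι).erase r : Finset ι) : Set ι)ᶜ p p := by
  have hfar : ∀ l ∉ ({i, j, k} : Finset ι),
      angle (x r) (x l) ∈ Set.Icc (δ / 2) (π - δ / 2) := fun l hl =>
    angle_mem_Icc_of_angle_le hrk (hsep (by grind) (by grind) (by grind))
  have hcases : ∀ m ∉ ({i, j, k} : Finset ι).erase r, m = r ∨ m ∉ ({i, j, k} : Finset ι) := by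
    grind
  suffices ∀ m ∉ ({i, j, k} : Finset ι).erase r, ∀ l ∉ ({i, j, k} : Finset ι).erase r, m ≠ l →
      angle (x m) (x l) ∈ Set.Icc (δ / 2) (π - δ / 2) from fun m hm l hl hml =>
    (this m hm l hl hml).imp_right Or.inl
  intro m hm l hl hml
  rcases hcases m hm with rfl | hm' <;> rcases hcases l hl with rfl | hl'
  · exact absurd rfl hml
  · exact hfar l hl'
  · exact angle_comm (x m) (x l) ▸ hfar m hm'
  · obtain ⟨h₁, h₂⟩ := hsep (x := m) (y := l) (by grind) (by grind) hml
    exact ⟨by linarith, by linarith⟩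

lemma exists_antipodal {δ τ : ℝ} (hτ : 2 * τ < δ) {i j : ι}
    (hsep : ({i, j}ᶜ : Set ι).Pairwise fun k l => angle (x k) (x l) ∈ Set.Icc δ (π - δ)) :
    ∃ q, ∀ k ∈ ({i, j}ᶜ : Set ι), k ≠ q → angle (x i) (x k) ≤ π - τ := by
  by_contra! h
  obtain ⟨k, hk, -, hik⟩ := h i
  obtain ⟨l, hl, hlk, hil⟩ := h k
  have htri := angle_le_angle_add_angle (x k) (-x i) (x l)
  rw [angle_neg_right, angle_neg_left, angle_comm (x k) (x i)] at htri
  linarith [(hsep hk hl hlk.symm).1]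

lemma AngleSeparatedOn.exists_of_isolated {δ τ : ℝ} (hτ : 0 ≤ τ) (hτδ : 2 * τ < δ) {i j : ι}
    (hsep : ({i, j}ᶜ : Set ι).Pairwise fun k l => angle (x k) (x l) ∈ Set.Icc δ (π - δ))
    (hfar : ∀ k, k ≠ i → k ≠ j → τ ≤ angle (x i) (x k)) :
    ∃ q, AngleSeparatedOn τ x {j}ᶜ i q := by
  obtain ⟨q, hq⟩ := exists_antipodal hτδ hsep
  have hi : ∀ k, k ≠ i → k ≠ j →
      τ ≤ angle (x i) (x k) ∧ (angle (x i) (x k) ≤ π - τ ∨ s(i, k) = s(i, q)) := fun k hki hkj =>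
    ⟨hfar k hki hkj, or_iff_not_imp_right.2 fun h => hq k (by simp [hki, hkj]) fun e => h (e ▸ rfl)⟩
  refine ⟨q, fun m hm l hl hml => ?_⟩
  by_cases hmi : m = i
  · exact hmi ▸ hi l (hmi ▸ hml.symm) hl
  by_cases hli : l = i
  · rw [angle_comm, Sym2.eq_swap]
    exact hli ▸ hi m hmi hm
  obtain ⟨h₁, h₂⟩ := hsep (x := m) (y := l) (by grind) (by grind) hml
  exact ⟨by linarith, .inl (by linarith)⟩

variable [Fintype ι]

/-- The bound `|w ⬝ᵥ y| ≤ C * ‖K w‖_∞ * A` for all weights `w` and all labels `y` that are bounded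
by `A` and `A`-Lipschitz with respect to the angle, `K` being the tangent kernel matrix. -/
def HasDualBound (L : ℕ) (x : ι → E) (C : ℝ) : Prop :=
  ∀ (w y : ι → ℝ) (A F : ℝ), (∀ k l, |y k - y l| ≤ A * angle (x k) (x l)) → (∀ k, |y k| ≤ A) →
    (∀ k, |(profileMatrix L x *ᵥ w) k| ≤ F) → |w ⬝ᵥ y| ≤ C * A * F

lemma exists_hasDualBound_of_cluster [FiniteDimensional ℝ E] (hL : 1 ≤ L) {δ : ℝ} (hδ : 0 < δ) :
    ∃ ω > 0, ∃ C > 0, ∀ x : ι → E, (∀ k, ‖x k‖ = 1) → ∀ (s : Finset ι) (r p q : ι), r ∉ s →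
      s.card ≤ 2 → (∀ k ∈ s, ∀ l ∈ s, k ≠ l → angle (x k) (x r) ≤ angle (x k) (x l)) →
      (∀ k ∈ s, angle (x k) (x r) ≤ ω) → AngleSeparatedOn δ x (s : Set ι)ᶜ p q →
      HasDualBound L x C := by
  classical
  obtain ⟨c, η, hc, hη, hslope⟩ := exists_ntkProfile_slope hL
  obtain ⟨Λ, hΛ, hlip⟩ := exists_abs_profileMatrix_sub_le (ι := ι) (E := E) L
  obtain ⟨μ, hμ, hcoer⟩ := exists_coercive (ι := ι) (E := E) hL hδ
  set ν : ℝ := Fintype.card ι / μ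
  have hν0 : 0 ≤ ν := by positivity
  refine ⟨min (η / 2) (7 / 10 * c / (4 * Λ ^ 2 * (ν + 1))), by positivity,
    ν * (1 + Λ * (4 * Fintype.card ι / (7 / 10 * c) + 1)) +
      (4 * Fintype.card ι / (7 / 10 * c) + 1), by positivity, ?_⟩
  intro x hx s r p q hr hs hapex hclose hsep w y A F hyl hyA hF
  refine abs_dotProduct_le_of_dominant_dipoles
    (isHermitian_iff_isSymm.1 (isHermitian_profileMatrix L x)) hμ (by positivity) hΛ
    (fun k _ => angle_nonneg (x k) (x r)) (fun k _ m => hlip x k r m)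
    (fun l hl => dipoleMatrix_profileMatrix_dominant hx hc hslope hs hapex
      (fun k hk => (hclose k hk).trans (min_le_left _ _)) hl)
    (hcoer x hx _ p q hsep _ fun k hk => mergeWeights_apply_of_mem hr (by simpa using hk) w)
    ?_ hF hyA fun k _ => hyl k r
  have hsum : ∑ k ∈ s, angle (x k) (x r) ≤ 2 * (7 / 10 * c / (4 * Λ ^ 2 * (ν + 1))) := by
    refine (Finset.sum_le_card_nsmul s _ _ fun k hk =>
      (hclose k hk).trans (min_le_right _ _)).trans ?_
    rw [nsmul_eq_mul]
    gcongr
    exact_mod_cast hs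
  calc 2 * Λ ^ 2 * (∑ k ∈ s, angle (x k) (x r)) * ν
      ≤ 2 * Λ ^ 2 * (2 * (7 / 10 * c / (4 * Λ ^ 2 * (ν + 1)))) * (ν + 1) := by
        gcongr
        exact le_add_of_nonneg_right zero_le_one
    _ = 7 / 10 * c := by field_simp; norm_num

lemma HasDualBound.mono [Nonempty ι] {C C' : ℝ} (h : HasDualBound L x C) (hC : C ≤ C') :
    HasDualBound L x C' := fun w y A F hyl hyA hF => by
  inhabit ι
  have hA : 0 ≤ A := (abs_nonneg _).trans (hyA default)
  have hF0 : 0 ≤ F := (abs_nonneg _).trans (hF default)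
  exact (h w y A F hyl hyA hF).trans (by gcongr)

/-- If a third input `x k` is close to `x i`, the cluster consists of `i`, `j`, `k`; otherwise it is
the pair `i`, `j`, and at most one input is nearly opposite to `x i`. -/
lemma exists_hasDualBound [FiniteDimensional ℝ E] (hL : 1 ≤ L) {δ : ℝ} (hδ : 0 < δ) :
    ∃ ω > 0, ∃ C > 0, ∀ x : ι → E, (∀ k, ‖x k‖ = 1) → ∀ i j, i ≠ j →
      ({i, j}ᶜ : Set ι).Pairwise (fun k l => angle (x k) (x l) ∈ Set.Icc δ (π - δ)) →
      angle (x i) (x j) ≤ ω → HasDualBound L x C := by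
  classical
  obtain ⟨ω₁, hω₁, C₁, hC₁, h₁⟩ := exists_hasDualBound_of_cluster (ι := ι) (E := E) hL (half_pos hδ)
  set τ := min (ω₁ / 2) (δ / 4)
  have hτ0 : 0 < τ := by positivity
  have hτω : τ ≤ ω₁ / 2 := min_le_left _ _
  have hτδ : τ ≤ δ / 4 := min_le_right _ _
  obtain ⟨ω₂, hω₂, C₂, -, h₂⟩ := exists_hasDualBound_of_cluster (ι := ι) (E := E) hL hτ0
  refine ⟨min τ ω₂, by positivity, max C₁ C₂, by positivity, fun x hx i j hij hsep hclose => ?_⟩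
  have : Nonempty ι := ⟨i⟩
  by_cases hthird : ∃ k, k ≠ i ∧ k ≠ j ∧ angle (x i) (x k) ≤ τ
  · obtain ⟨k, hki, hkj, hik⟩ := hthird
    have hball : ∀ a ∈ ({i, j, k} : Finset ι), angle (x i) (x a) ≤ τ := by
      simp only [Finset.mem_insert, Finset.mem_singleton, forall_eq_or_imp, forall_eq]
      exact ⟨by rw [angle_self (norm_ne_zero_iff.1 (by simp [hx i]))]; exact hτ0.le,
        hclose.trans (min_le_left _ _), hik⟩
    have hdiam : ∀ a ∈ ({i, j, k} : Finset ι), ∀ b ∈ ({i, j, k} : Finset ι),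
        angle (x a) (x b) ≤ 2 * τ := fun a ha b hb => by
      have htri := angle_le_angle_add_angle (x a) (x i) (x b)
      rw [angle_comm (x a) (x i)] at htri
      linarith [hball a ha, hball b hb]
    obtain ⟨r, hr, hapex⟩ := exists_apex (D := fun a b => angle (x a) (x b))
      (fun a b => angle_comm _ _) i j k
    refine (h₁ x hx (({i, j, k} : Finset ι).erase r) r i i (Finset.notMem_erase _ _) ?_ hapex
      (fun a ha => (hdiam a (Finset.mem_of_mem_erase ha) r hr).trans (by linarith))
      (.of_close hδ.le hki hkj hsep ((hdiam r hr k (by simp)).trans (by linarith)) i)).mono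
      (le_max_left _ _)
    have := Finset.card_erase_of_mem hr
    have := Finset.card_le_three (a := i) (b := j) (c := k)
    omega
  · push Not at hthird
    obtain ⟨q, hq⟩ := AngleSeparatedOn.exists_of_isolated hτ0.le (by linarith) hsep
      fun k hki hkj => (hthird k hki hkj).le
    refine (h₂ x hx {j} i i q (by simpa using hij) (by simp) (by simp) ?_ (by simpa using hq)).mono
      (le_max_right _ _)
    simpa [angle_comm] using hclose.trans (min_le_right _ _)

end DualBound

/-! ### The small eigenvalue -/

section Eigenpair

variable {ι E : Type*} [NormedAddCommGroup E] [InnerProductSpace ℝ E] {L : ℕ} {x : ι → E}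

lemma eq_or_half_angle_le_of_third_close {a b k : ι} (hka : k ≠ a) (hkb : k ≠ b)
    (hk : angle (x a) (x k) < angle (x a) (x b) / 2)
    (hsep : ({a, b}ᶜ : Set ι).Pairwise fun m l => 2 * angle (x a) (x b) ≤ angle (x m) (x l))
    {m l : ι} (hml : m ≠ l) :
    s(m, l) = s(a, k) ∨ angle (x a) (x b) / 2 ≤ angle (x m) (x l) := by
  have hθ : 0 ≤ angle (x a) (x b) := angle_nonneg _ _
  have hbk : angle (x a) (x b) / 2 ≤ angle (x b) (x k) ∧
      angle (x b) (x k) ≤ 3 / 2 * angle (x a) (x b) := by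
    have := abs_le.1 (abs_angle_sub_angle_le (x b) (x a) (x k))
    have := angle_le_angle_add_angle (x b) (x k) (x a)
    rw [angle_comm (x k) (x a)] at this
    rw [angle_comm (x b) (x a)] at *
    constructor <;> linarith
  have hk_other : ∀ l ∉ ({a, b} : Set ι), l ≠ k → 2 * angle (x a) (x b) ≤ angle (x k) (x l) :=
    fun l hl hlk => hsep (by simp [hka, hkb]) hl hlk.symm
  have ha_other : ∀ l ∉ ({a, b} : Set ι), l ≠ k →
      angle (x a) (x b) / 2 ≤ angle (x a) (x l) := fun l hl hlk => by
    have := abs_le.1 (abs_angle_sub_angle_le (x a) (x k) (x l))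
    linarith [hk_other l hl hlk]
  have hb_other : ∀ l ∉ ({a, b} : Set ι), l ≠ k →
      angle (x a) (x b) / 2 ≤ angle (x b) (x l) := fun l hl hlk => by
    have := abs_le.1 (abs_angle_sub_angle_le (x b) (x k) (x l))
    linarith [hk_other l hl hlk]
  have hother : ∀ m ∉ ({a, b} : Set ι), ∀ l ∉ ({a, b} : Set ι), m ≠ l →
      angle (x a) (x b) / 2 ≤ angle (x m) (x l) := fun m hm l hl h => by
    linarith [hsep hm hl h]
  have hcomm : ∀ m l, angle (x m) (x l) = angle (x l) (x m) := fun m l => angle_comm _ _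
  rw [Sym2.eq_iff]
  grind

lemma exists_third_close {i j : ι}
    (hsep : ({i, j}ᶜ : Set ι).Pairwise fun m l => 2 * angle (x i) (x j) ≤ angle (x m) (x l))
    {m l : ι} (hml : m ≠ l) (h : angle (x m) (x l) < angle (x i) (x j) / 2) :
    ∃ k, k ≠ i ∧ k ≠ j ∧ (angle (x i) (x k) < angle (x i) (x j) / 2 ∨
      angle (x j) (x k) < angle (x i) (x j) / 2) := by
  have hθ : 0 ≤ angle (x i) (x j) := angle_nonneg _ _
  have hnot : ∀ m ∉ ({i, j} : Set ι), ∀ l ∉ ({i, j} : Set ι), m ≠ l →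
      angle (x i) (x j) / 2 ≤ angle (x m) (x l) := fun m hm l hl h => by
    linarith [hsep hm hl h]
  have hcomm : ∀ m l, angle (x m) (x l) = angle (x l) (x m) := fun m l => angle_comm _ _
  grind

lemma finrank_span_single_sub_single [DecidableEq ι] {a b k : ι} (hab : a ≠ b) (hka : k ≠ a)
    (hkb : k ≠ b) :
    Module.finrank ℝ (Submodule.span ℝ
      {Pi.single b 1 - Pi.single a 1, (Pi.single k 1 - Pi.single a 1 : ι → ℝ)}) = 2 := by
  have hind : LinearIndependent ℝ
      ![Pi.single b 1 - Pi.single a 1, (Pi.single k 1 - Pi.single a 1 : ι → ℝ)] :=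
    LinearIndependent.pair_iff.2 fun α β h =>
      ⟨by simpa [hab.symm, hkb.symm] using congrFun h b, by simpa [hka, hkb] using congrFun h k⟩
  rw [← Matrix.range_cons_cons_empty _ _ ![], finrank_span_eq_card hind, Fintype.card_fin]

variable [Fintype ι]

lemma dotProduct_mulVec_le_of_sum_eq_zero {K : Matrix ι ι ℝ} {s : Finset ι} {r : ι} {ε : ℝ}
    {u : ι → ℝ} (hu : ∀ k ∉ s, u k = 0) (hsum : ∑ k, u k = 0)
    (hK : ∀ m ∈ s, ∀ l ∈ s, |K m l - K r l| ≤ ε) :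
    u ⬝ᵥ K *ᵥ u ≤ ε * s.card * (u ⬝ᵥ u) := by
  rcases s.eq_empty_or_nonempty with rfl | ⟨m₀, hm₀⟩
  · simp [show u = 0 from funext fun k => hu k (Finset.notMem_empty k)]
  have hε : 0 ≤ ε := (abs_nonneg _).trans (hK m₀ hm₀ m₀ hm₀)
  have e : u ⬝ᵥ K *ᵥ u = ∑ m ∈ s, ∑ l ∈ s, u m * u l * (K m l - K r l) := by
    have hbase : ∑ m, ∑ l, u m * u l * K r l = 0 := by
      simp only [mul_assoc, ← Finset.mul_sum, ← Finset.sum_mul, hsum, zero_mul]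
    have hsupp : ∀ m, ∑ l ∈ s, u m * u l * (K m l - K r l) =
        ∑ l, u m * u l * (K m l - K r l) := fun m =>
      Finset.sum_subset s.subset_univ fun l _ hl => by simp [hu l hl]
    simp only [hsupp]
    rw [Finset.sum_subset s.subset_univ fun m _ hm => by simp [hu m hm],
      dotProduct_mulVec_eq_sum, ← sub_zero (∑ m, ∑ l, u m * u l * K m l), ← hbase]
    simp only [← Finset.sum_sub_distrib, mul_sub]
  calc u ⬝ᵥ K *ᵥ u ≤ ∑ m ∈ s, ∑ l ∈ s, |u m| * |u l| * ε := by
        rw [e]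
        refine Finset.sum_le_sum fun m hm => Finset.sum_le_sum fun l hl => ?_
        refine (le_abs_self _).trans ?_
        rw [abs_mul, abs_mul]
        exact mul_le_mul_of_nonneg_left (hK m hm l hl) (by positivity)
    _ = ε * (∑ m ∈ s, |u m|) ^ 2 := by
        rw [sq, Finset.sum_mul_sum, mul_comm]
        simp only [Finset.sum_mul]
    _ ≤ ε * (s.card * ∑ m ∈ s, |u m| ^ 2) := by
        gcongr
        exact sq_sum_le_card_mul_sum_sq
    _ = ε * s.card * (u ⬝ᵥ u) := by
        rw [mul_assoc, Finset.sum_subset s.subset_univ fun m _ hm => by simp [hu m hm]]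
        simp only [sq, abs_mul_abs_self, dotProduct]

variable (L x) in
/-- A unit eigenvector `v` of the tangent kernel matrix `K` with eigenvalue `lam`, and a unit vector
`u` bounding `lam` from below by the dual estimate: `ρ • u` is Lipschitz with respect to the angle
and `‖K u‖ ≤ lam`. -/
structure IsTestedEigenpair (ρ lam : ℝ) (v u : ι → ℝ) : Prop where
  nonneg : 0 ≤ lam
  unit : v ⬝ᵥ v = 1
  mulVec_eq : profileMatrix L x *ᵥ v = lam • v
  test_unit : u ⬝ᵥ u = 1
  test_eq_or_le : ∀ k l, u k = u l ∨ ρ ≤ angle (x k) (x l)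
  test_le : profileMatrix L x *ᵥ u ⬝ᵥ profileMatrix L x *ᵥ u ≤ lam ^ 2

variable {Λ : ℝ}

lemma dotProduct_profileMatrix_le_of_near (hΛ : 0 ≤ Λ)
    (hlip : ∀ k l m, |profileMatrix L x k m - profileMatrix L x l m| ≤ Λ * angle (x k) (x l))
    {s : Finset ι} {r : ι} {θ : ℝ} (hs : ∀ m ∈ s, angle (x m) (x r) ≤ θ) {u : ι → ℝ}
    (hu : ∀ k ∉ s, u k = 0) (hsum : ∑ k, u k = 0) :
    u ⬝ᵥ profileMatrix L x *ᵥ u ≤ Λ * θ * s.card * (u ⬝ᵥ u) :=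
  dotProduct_mulVec_le_of_sum_eq_zero hu hsum fun m hm l _ =>
    (hlip m r l).trans (mul_le_mul_of_nonneg_left (hs m hm) hΛ)

lemma exists_isTestedEigenpair_of_separated (hx : ∀ k, ‖x k‖ = 1) (hΛ : 0 ≤ Λ)
    (hlip : ∀ k l m, |profileMatrix L x k m - profileMatrix L x l m| ≤ Λ * angle (x k) (x l))
    {i j : ι} (hij : i ≠ j)
    (hsep : ∀ m l, m ≠ l → angle (x i) (x j) / 2 ≤ angle (x m) (x l)) :
    ∃ lam v u, IsTestedEigenpair L x (angle (x i) (x j) / 2) lam v u ∧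
      lam ≤ 2 * Λ * angle (x i) (x j) := by
  classical
  have hne : (Pi.single i 1 - Pi.single j 1 : ι → ℝ) ≠ 0 := fun h => by
    simpa [hij] using congrFun h i
  have hform := dotProduct_profileMatrix_le_of_near hΛ hlip (s := {i, j}) (r := j)
    (θ := angle (x i) (x j)) (u := Pi.single i 1 - Pi.single j 1)
    (by simp [angle_self (norm_ne_zero_iff.1 ((hx j).trans_ne one_ne_zero)), angle_nonneg])
    (fun k hk => by grind [Pi.sub_apply]) (by simp)
  rw [Finset.card_pair hij, Nat.cast_ofNat] at hform
  obtain ⟨lam, v, h₀, h₁, h₂, h₃⟩ :=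
    exists_eigenvector_of_rayleigh (posSemidef_profileMatrix L hx) hne hform
  refine ⟨lam, v, v, ⟨h₀, h₂, h₃, h₂, fun k l => ?_, ?_⟩, by linarith⟩
  · exact or_iff_not_imp_left.2 fun h => hsep k l fun e => h (e ▸ rfl)
  · rw [h₃, dotProduct_smul, smul_dotProduct, h₂, smul_eq_mul, smul_eq_mul, mul_one, sq]

/-- With a third input close to the pair, the second smallest eigenvalue is still of order `θ`, and
the test vector can be chosen to agree at the two inputs closest to each other. -/
lemma exists_isTestedEigenpair_of_third_close (hx : ∀ k, ‖x k‖ = 1) (hΛ : 0 ≤ Λ)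
    (hlip : ∀ k l m, |profileMatrix L x k m - profileMatrix L x l m| ≤ Λ * angle (x k) (x l))
    {a b k : ι} (hab : a ≠ b) (hka : k ≠ a) (hkb : k ≠ b)
    (hk : angle (x a) (x k) < angle (x a) (x b) / 2)
    (hsep : ({a, b}ᶜ : Set ι).Pairwise fun m l => 2 * angle (x a) (x b) ≤ angle (x m) (x l)) :
    ∃ lam v u, IsTestedEigenpair L x (angle (x a) (x b) / 2) lam v u ∧
      lam ≤ 3 * Λ * angle (x a) (x b) := by
  classical
  have hθ : 0 ≤ angle (x a) (x b) := angle_nonneg _ _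
  have hball : ∀ m ∈ ({a, b, k} : Finset ι), angle (x m) (x a) ≤ angle (x a) (x b) := by
    simp only [Finset.mem_insert, Finset.mem_singleton, forall_eq_or_imp, forall_eq,
      angle_self (norm_ne_zero_iff.1 ((hx a).trans_ne one_ne_zero)), angle_comm _ (x a)]
    exact ⟨hθ, le_rfl, by linarith⟩
  have hform : ∀ u ∈ Submodule.span ℝ
      {Pi.single b 1 - Pi.single a 1, (Pi.single k 1 - Pi.single a 1 : ι → ℝ)},
      u ⬝ᵥ profileMatrix L x *ᵥ u ≤ Λ * angle (x a) (x b) * 3 * (u ⬝ᵥ u) := by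
    intro u hu
    obtain ⟨α, β, rfl⟩ := Submodule.mem_span_pair.1 hu
    have := dotProduct_profileMatrix_le_of_near hΛ hlip hball
      (u := α • (Pi.single b 1 - Pi.single a 1) + β • (Pi.single k 1 - Pi.single a 1))
      (fun m hm => by
        simp only [Finset.mem_insert, Finset.mem_singleton, not_or] at hm
        simp [hm.1, hm.2.1, hm.2.2])
      (by simp [Finset.sum_add_distrib, ← Finset.mul_sum])
    rwa [Finset.card_eq_three.2 ⟨a, b, k, hab, hka.symm, hkb.symm, rfl⟩, Nat.cast_ofNat] at this
  obtain ⟨lam, v, u, h₀, h₁, h₂, h₃, h₄, hfu, h₅⟩ := exists_eigenvector_of_plane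
    (posSemidef_profileMatrix L hx) (finrank_span_single_sub_single hab hka hkb).ge hform
    (LinearMap.proj (R := ℝ) (φ := fun _ : ι => ℝ) a - LinearMap.proj k)
  have hu : u a = u k := sub_eq_zero.1 hfu
  refine ⟨lam, v, u, ⟨h₀, h₂, h₃, h₄, fun m l => ?_, h₅⟩, by linarith⟩
  by_cases hml : m = l
  · exact .inl (hml ▸ rfl)
  refine (eq_or_half_angle_le_of_third_close hka hkb hk hsep hml).imp_left fun h => ?_
  rcases Sym2.eq_iff.1 h with ⟨rfl, rfl⟩ | ⟨rfl, rfl⟩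
  exacts [hu, hu.symm]

lemma exists_isTestedEigenpair (hx : ∀ k, ‖x k‖ = 1) (hΛ : 0 ≤ Λ)
    (hlip : ∀ k l m, |profileMatrix L x k m - profileMatrix L x l m| ≤ Λ * angle (x k) (x l))
    {i j : ι} (hij : i ≠ j)
    (hsep : ({i, j}ᶜ : Set ι).Pairwise fun m l => 2 * angle (x i) (x j) ≤ angle (x m) (x l)) :
    ∃ lam v u, IsTestedEigenpair L x (angle (x i) (x j) / 2) lam v u ∧
      lam ≤ 3 * Λ * angle (x i) (x j) := by
  by_cases h : ∀ m l, m ≠ l → angle (x i) (x j) / 2 ≤ angle (x m) (x l)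
  · obtain ⟨lam, v, u, htest, hle⟩ := exists_isTestedEigenpair_of_separated hx hΛ hlip hij h
    have := mul_nonneg hΛ (angle_nonneg (x i) (x j))
    exact ⟨lam, v, u, htest, by linarith⟩
  push Not at h
  obtain ⟨m, l, hml, hlt⟩ := h
  obtain ⟨k, hki, hkj, hk | hk⟩ := exists_third_close hsep hml hlt
  · exact exists_isTestedEigenpair_of_third_close hx hΛ hlip hij hki hkj hk hsep
  · rw [Set.pair_comm] at hsep
    rw [angle_comm (x i) (x j)] at *
    exact exists_isTestedEigenpair_of_third_close hx hΛ hlip hij.symm hkj hki hk (by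
      simpa only [angle_comm (x i) (x j)] using hsep)

end Eigenpair

section Conclusion

variable {ι E : Type*} [Fintype ι] [NormedAddCommGroup E] [InnerProductSpace ℝ E] {L : ℕ}
  {x : ι → E} {C ρ lam : ℝ} {v u : ι → ℝ}

lemma abs_apply_le_of_dotProduct_self_le {u : ι → ℝ} {r : ℝ} (hr : 0 ≤ r) (h : u ⬝ᵥ u ≤ r ^ 2)
    (k : ι) : |u k| ≤ r := by
  refine abs_le_of_sq_le_sq (le_trans ?_ h) hr
  rw [sq]
  exact Finset.single_le_sum (fun l _ => mul_self_nonneg (u l)) (Finset.mem_univ k)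

lemma IsTestedEigenpair.abs_apply_le_one (h : IsTestedEigenpair L x ρ lam v u) (k : ι) :
    |v k| ≤ 1 :=
  abs_apply_le_of_dotProduct_self_le zero_le_one (by rw [h.unit, one_pow]) k

lemma IsTestedEigenpair.abs_mul_apply_le (h : IsTestedEigenpair L x ρ lam v u) (k : ι) :
    |lam * v k| ≤ lam := by
  rw [abs_mul, abs_of_nonneg h.nonneg]
  exact mul_le_of_le_one_right h.nonneg (h.abs_apply_le_one k)

lemma IsTestedEigenpair.le_of_hasDualBound (h : IsTestedEigenpair L x ρ lam v u)
    (hdual : HasDualBound L x C) (hρ : ρ ∈ Set.Icc 0 2) : ρ ≤ C * 2 * lam := by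
  have hu := abs_apply_le_of_dotProduct_self_le zero_le_one (by rw [h.test_unit, one_pow])
  have hdiff : ∀ k l, |(ρ • u) k - (ρ • u) l| ≤ 2 * angle (x k) (x l) := fun k l => by
    rw [Pi.smul_apply, Pi.smul_apply, smul_eq_mul, smul_eq_mul, ← mul_sub, abs_mul,
      abs_of_nonneg hρ.1]
    rcases h.test_eq_or_le k l with hkl | hkl
    · simp [hkl, angle_nonneg]
    · calc ρ * |u k - u l| ≤ angle (x k) (x l) * 2 := by
            gcongr
            · exact angle_nonneg _ _
            · exact (abs_sub _ _).trans (by linarith [hu k, hu l])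
        _ = 2 * angle (x k) (x l) := mul_comm _ _
  have hbound : ∀ k, |(ρ • u) k| ≤ 2 := fun k => by
    rw [Pi.smul_apply, smul_eq_mul, abs_mul, abs_of_nonneg hρ.1]
    exact (mul_le_of_le_one_right hρ.1 (hu k)).trans hρ.2
  have := hdual u (ρ • u) 2 lam hdiff hbound
    (abs_apply_le_of_dotProduct_self_le h.nonneg h.test_le)
  rw [dotProduct_smul, h.test_unit, smul_eq_mul, mul_one] at this
  exact (le_abs_self ρ).trans this

lemma IsTestedEigenpair.sq_dotProduct_le (h : IsTestedEigenpair L x ρ lam v u)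
    (hdual : HasDualBound L x C) (hx : ∀ k, ‖x k‖ = 1) {A : ℝ} (hA : 0 ≤ A) {y : ι → ℝ}
    (hy : ∀ k l, |y k - y l| ≤ A * ‖x k - x l‖) (hyA : ∀ k, |y k| ≤ A) :
    (v ⬝ᵥ y) ^ 2 ≤ (C * A) ^ 2 * lam ^ 2 := by
  have hF : ∀ k, |(profileMatrix L x *ᵥ v) k| ≤ lam := fun k => by
    rw [h.mulVec_eq]
    exact h.abs_mul_apply_le k
  have hbound : |v ⬝ᵥ y| ≤ C * A * lam := hdual v y A lam
    (fun k l => (hy k l).trans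
      (mul_le_mul_of_nonneg_left (norm_sub_le_angle (hx k) (hx l)) hA)) hyA hF
  rw [← mul_pow, ← sq_abs]
  gcongr

lemma IsTestedEigenpair.abs_mul_sub_mul_le (h : IsTestedEigenpair L x ρ lam v u)
    (hx : ∀ k, ‖x k‖ = 1) {Λ : ℝ} (hΛ : 0 ≤ Λ)
    (hlip : ∀ k l m, |profileMatrix L x k m - profileMatrix L x l m| ≤ Λ * angle (x k) (x l))
    (k l : ι) : |lam * v k - lam * v l| ≤ Fintype.card ι * (Λ * (π / 2 * ‖x k - x l‖)) := by
  have hKv : ∀ k, lam * v k = ∑ m, profileMatrix L x k m * v m := fun k =>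
    (congrFun h.mulVec_eq k).symm
  calc |lam * v k - lam * v l|
      = |∑ m, (profileMatrix L x k m - profileMatrix L x l m) * v m| := by
        simp only [hKv, sub_mul, Finset.sum_sub_distrib]
    _ ≤ ∑ m, |(profileMatrix L x k m - profileMatrix L x l m) * v m| :=
        Finset.abs_sum_le_sum_abs _ _
    _ ≤ ∑ _m : ι, Λ * (π / 2 * ‖x k - x l‖) := by
        refine Finset.sum_le_sum fun m _ => ?_
        rw [abs_mul]
        refine (mul_le_of_le_one_right (abs_nonneg _) (h.abs_apply_le_one m)).trans
          ((hlip k l m).trans ?_)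
        gcongr
        exact angle_le_norm_sub (hx k) (hx l)
    _ = Fintype.card ι * (Λ * (π / 2 * ‖x k - x l‖)) := by
        rw [Finset.sum_const, Finset.card_univ, nsmul_eq_mul]

/-- The extremal labels are `y = τ • K v = (τ * lam) • v`: they inherit a Lipschitz bound from the
rows of `K`. -/
lemma IsTestedEigenpair.exists_attaining_labels (h : IsTestedEigenpair L x ρ lam v u)
    (hx : ∀ k, ‖x k‖ = 1) {Λ : ℝ} (hΛ : 0 ≤ Λ)
    (hlip : ∀ k l m, |profileMatrix L x k m - profileMatrix L x l m| ≤ Λ * angle (x k) (x l))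
    {τ Ly M : ℝ} (hτ : 0 ≤ τ) (hLy : τ * (Fintype.card ι * (Λ * (π / 2))) ≤ Ly)
    (hM : τ * lam ≤ M) :
    ∃ y : ι → ℝ, (∀ k l, |y k - y l| ≤ Ly * ‖x k - x l‖) ∧ (∀ k, |y k| ≤ M) ∧
      τ ^ 2 * lam ^ 2 ≤ (v ⬝ᵥ y) ^ 2 := by
  refine ⟨fun k => τ * (lam * v k), fun k l => ?_, fun k => ?_, ?_⟩
  · rw [← mul_sub, abs_mul, abs_of_nonneg hτ]
    calc τ * |lam * v k - lam * v l|
        ≤ τ * (Fintype.card ι * (Λ * (π / 2 * ‖x k - x l‖))) := by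
          gcongr
          exact h.abs_mul_sub_mul_le hx hΛ hlip k l
      _ = τ * (Fintype.card ι * (Λ * (π / 2))) * ‖x k - x l‖ := by ring
      _ ≤ Ly * ‖x k - x l‖ := by gcongr
  · rw [abs_mul, abs_of_nonneg hτ]
    exact (mul_le_mul_of_nonneg_left (h.abs_mul_apply_le k) hτ).trans hM
  · have : v ⬝ᵥ (fun k => τ * (lam * v k)) = τ * lam := by
      rw [show (fun k => τ * (lam * v k)) = (τ * lam) • v from funext fun k => by simp [mul_assoc],
        dotProduct_smul, h.unit, smul_eq_mul, mul_one]
    rw [this, mul_pow]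

end Conclusion

section Inputs

variable {n d : ℕ}

lemma of_ntk_eq_profileMatrix {ι : Type*} (L : ℕ) {x : ι → EuclideanSpace ℝ (Fin d)}
    (hx : ∀ k, ‖x k‖ = 1) : Matrix.of (fun k l => ntk L (x k) (x l)) = profileMatrix L x := by
  ext k l
  exact ntk_eq_ntkProfile L (hx k) (hx l)

lemma AdmissibleInputs.angle_mem_Ioo {x : Fin n → EuclideanSpace ℝ (Fin d)}
    (hx : AdmissibleInputs x) {k l : Fin n} (hkl : k ≠ l) :
    angle (x k) (x l) ∈ Set.Ioo 0 π := by
  refine ⟨(angle_nonneg _ _).lt_of_ne fun h => ?_, (angle_le_pi _ _).lt_of_ne fun h => ?_⟩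
  · obtain ⟨-, r, -, hr⟩ := angle_eq_zero_iff.1 h.symm
    exact hx.nonparallel l k hkl.symm ⟨r, hr⟩
  · obtain ⟨-, r, -, hr⟩ := angle_eq_pi_iff.1 h
    exact hx.nonparallel l k hkl.symm ⟨r, hr⟩

lemma exists_angle_mem_Icc_of_mem_Ioo {κ E : Type*} [Finite κ] [NormedAddCommGroup E]
    [InnerProductSpace ℝ E] (z : κ → E) :
    ∃ δ > 0, ∀ k l, angle (z k) (z l) ∈ Set.Ioo 0 π →
      angle (z k) (z l) ∈ Set.Icc δ (π - δ) := by
  have h : ∀ᶠ δ in 𝓝[>] (0 : ℝ), ∀ k l, angle (z k) (z l) ∈ Set.Ioo 0 π →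
      angle (z k) (z l) ∈ Set.Icc δ (π - δ) := by
    refine eventually_all.2 fun k => eventually_all.2 fun l =>
      eventually_imp_distrib_left.2 fun hkl => ?_
    filter_upwards [Ioo_mem_nhdsGT hkl.1, Ioo_mem_nhdsGT (sub_pos.2 hkl.2)] with δ h₁ h₂
    exact ⟨h₁.2.le, by linarith [h₂.2]⟩
  obtain ⟨δ, hδ, hpos⟩ := (h.and self_mem_nhdsWithin).exists
  exact ⟨δ, hpos, hδ⟩

lemma exists_pairwise_angle_mem_Icc {i j : Fin n}
    (z : {k : Fin n // k ≠ i ∧ k ≠ j} → EuclideanSpace ℝ (Fin d)) :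
    ∃ δ > 0, ∀ x : Fin n → EuclideanSpace ℝ (Fin d), AdmissibleInputs x →
      (∀ k : {k : Fin n // k ≠ i ∧ k ≠ j}, x k = z k) →
      ({i, j}ᶜ : Set (Fin n)).Pairwise fun k l => angle (x k) (x l) ∈ Set.Icc δ (π - δ) := by
  obtain ⟨δ, hδ, hz⟩ := exists_angle_mem_Icc_of_mem_Ioo z
  refine ⟨δ, hδ, fun x hx hxz k hk l hl hkl => ?_⟩
  have hk' : k ≠ i ∧ k ≠ j := by simpa using hk
  have hl' : l ≠ i ∧ l ≠ j := by simpa using hl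
  have := hz ⟨k, hk'⟩ ⟨l, hl'⟩
  rw [← hxz, ← hxz] at this
  exact this (hx.angle_mem_Ioo hkl)

end Inputs

end InfiniteNTK

end

open InfiniteNTK InnerProductGeometry in
theorem theorem3p2_general {ι : Type*} [Fintype ι] {d L : ℕ} (hL : 1 ≤ L) {Ly M δ : ℝ}
    (hLy : 0 < Ly) (hM : 0 < M) (hδ : 0 < δ) :
    ∃ c C θ₀ : ℝ, 0 < c ∧ 0 < C ∧ 0 < θ₀ ∧
      ∀ x : ι → EuclideanSpace ℝ (Fin d), (∀ k, ‖x k‖ = 1) → ∀ i j, i ≠ j →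
        (({i, j}ᶜ : Set ι).Pairwise fun k l => angle (x k) (x l) ∈ Set.Icc δ (Real.pi - δ)) →
        angle (x i) (x j) ≤ θ₀ →
        ∃ (lam : ℝ) (v : ι → ℝ),
          v ⬝ᵥ v = 1 ∧ Matrix.of (fun k l => ntk L (x k) (x l)) *ᵥ v = lam • v ∧
          c * angle (x i) (x j) ≤ lam ∧ lam ≤ C * angle (x i) (x j) ∧
          (∀ y : ι → ℝ, (∀ k l, |y k - y l| ≤ Ly * ‖x k - x l‖) → (∀ k, |y k| ≤ M) →
            (v ⬝ᵥ y) ^ 2 ≤ C * lam ^ 2) ∧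
          (∃ y : ι → ℝ, (∀ k l, |y k - y l| ≤ Ly * ‖x k - x l‖) ∧ (∀ k, |y k| ≤ M) ∧
            c * lam ^ 2 ≤ (v ⬝ᵥ y) ^ 2) := by
  obtain ⟨Λ, hΛ, hlip⟩ :=
    exists_abs_profileMatrix_sub_le (ι := ι) (E := EuclideanSpace ℝ (Fin d)) L
  obtain ⟨ω, hω, C₀, hC₀, hdual⟩ :=
    exists_hasDualBound (ι := ι) (E := EuclideanSpace ℝ (Fin d)) hL hδ
  have hΛ₀ : 0 ≤ Λ := zero_le_one.trans hΛ
  obtain ⟨τ, hτ, hτLy, hτM⟩ : ∃ τ > 0, τ * (Fintype.card ι * (Λ * (Real.pi / 2))) ≤ Ly ∧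
      τ * (3 * Λ * Real.pi) ≤ M := by
    obtain ⟨τ, hτ, h⟩ := exists_pos_mul_lt (lt_min hLy hM)
      (Fintype.card ι * (Λ * (Real.pi / 2)) + 3 * Λ * Real.pi)
    have h₁ : 0 ≤ τ * (Fintype.card ι * (Λ * (Real.pi / 2))) := by positivity
    have h₂ : 0 ≤ τ * (3 * Λ * Real.pi) := by positivity
    exact ⟨τ, hτ, by linarith [lt_min_iff.1 h], by linarith [lt_min_iff.1 h]⟩
  refine ⟨min (1 / (4 * C₀)) (τ ^ 2), max (3 * Λ) ((C₀ * max Ly M) ^ 2), min ω (δ / 2),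
    by positivity, by positivity, by positivity, fun x hx i j hij hsep hθ => ?_⟩
  obtain ⟨lam, v, u, h, hle⟩ := exists_isTestedEigenpair hx hΛ₀ (hlip x) hij
    fun k hk l hl hkl => by linarith [(hsep hk hl hkl).1, hθ.trans (min_le_right _ _)]
  have hdual := hdual x hx i j hij hsep (hθ.trans (min_le_left _ _))
  have hθ₀ := angle_nonneg (x i) (x j)
  have hθpi := angle_le_pi (x i) (x j)
  refine ⟨lam, v, h.unit, of_ntk_eq_profileMatrix L hx ▸ h.mulVec_eq, ?_, ?_, ?_, ?_⟩
  · have := h.le_of_hasDualBound hdual ⟨by linarith, by linarith [Real.pi_lt_four]⟩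
    calc min (1 / (4 * C₀)) (τ ^ 2) * angle (x i) (x j)
        ≤ 1 / (4 * C₀) * angle (x i) (x j) := by gcongr; exact min_le_left _ _
      _ ≤ lam := by rw [one_div_mul_eq_div, div_le_iff₀ (by positivity)]; linarith
  · exact hle.trans (mul_le_mul_of_nonneg_right (le_max_left _ _) hθ₀)
  · intro y hy hyM
    refine (h.sq_dotProduct_le hdual hx (A := max Ly M) (hLy.le.trans (le_max_left _ _))
      (fun k l => (hy k l).trans ?_) fun k => (hyM k).trans (le_max_right _ _)).trans ?_
    all_goals gcongr; simp
  · obtain ⟨y, hyLy, hyM, hy⟩ := h.exists_attaining_labels hx hΛ₀ (hlip x) hτ.le hτLy (M := M) <| by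
      refine le_trans ?_ hτM
      gcongr
      exact hle.trans (by gcongr)
    exact ⟨y, hyLy, hyM, le_trans (by gcongr; exact min_le_right _ _) hy⟩

/-- `n > 2` data points in `ℝᵈ`, a close pair `i ≠ j`, a network with `L ≥ 1` hidden layers.
The constants may depend on `n, d, L`, on the Lipschitz constant `Ly`, on a bound `M` for the
labels and on the data points other than `i, j` (the family `z`), but neither on the pair
`x i, x j` itself nor on the labels. -/
theorem theorem3p2 (n d L : ℕ) (hn : 2 < n) (hL : 1 ≤ L) (i j : Fin n) (hij : i ≠ j)
    (Ly M : ℝ) (hLy : 0 < Ly) (hM : 0 < M)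
    (z : {k : Fin n // k ≠ i ∧ k ≠ j} → EuclideanSpace ℝ (Fin d)) :
    ∃ c C θ₀ : ℝ, 0 < c ∧ 0 < C ∧ 0 < θ₀ ∧
      ∀ x : Fin n → EuclideanSpace ℝ (Fin d),
        InfiniteNTK.AdmissibleInputs x →
        (∀ k : {k : Fin n // k ≠ i ∧ k ≠ j}, x k = z k) →
        InnerProductGeometry.angle (x i) (x j) ≤ θ₀ →
        ∃ (lam : ℝ) (v : Fin n → ℝ),
          -- an eigenpair of the NTK matrix with a unit eigenvector
          v ⬝ᵥ v = 1 ∧ InfiniteNTK.ntkMatrix L x *ᵥ v = lam • v ∧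
          -- the eigenvalue is of order `θ`
          c * InnerProductGeometry.angle (x i) (x j) ≤ lam ∧
          lam ≤ C * InnerProductGeometry.angle (x i) (x j) ∧
          -- the squared label projection is of order at most `lam ^ 2` for all admissible labels
          (∀ y : Fin n → ℝ, InfiniteNTK.LipschitzLabels Ly x y → (∀ k, |y k| ≤ M) →
            (v ⬝ᵥ y) ^ 2 ≤ C * lam ^ 2) ∧
          -- and the order `lam ^ 2` is attained by some admissible labels
          (∃ y : Fin n → ℝ, InfiniteNTK.LipschitzLabels Ly x y ∧ (∀ k, |y k| ≤ M) ∧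
            c * lam ^ 2 ≤ (v ⬝ᵥ y) ^ 2) := by
  obtain ⟨δ, hδ, hsep⟩ := InfiniteNTK.exists_pairwise_angle_mem_Icc z
  obtain ⟨c, C, θ₀, hc, hC, hθ₀, h⟩ := theorem3p2_general (ι := Fin n) (d := d) hL hLy hM hδ
  exact ⟨c, C, θ₀, hc, hC, hθ₀, fun x hx hxz => h x hx.unit i j hij (hsep x hx hxz)⟩
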